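/- Let $\Gamma$ be a finite group acting faithfully and linearly on a finite dimensional real vector space $V$ with a $\Gamma$-invariant inner product. For $\gamma\in\Gamma$ let $V^\gamma$ be the subspace fixed by $\gamma$, $N^\gamma$ its orthogonal complement, and $l(\gamma)=\dim N^\gamma$; identify $(V^\gamma)^*$ with the linear forms on $V$ that vanish on $N^\gamma$, so that $V^*=(V^\gamma)^*\oplus (N^\gamma)^*$. Let $\pi\in V^*\otimes\wedge^2V$ be a $\Gamma$-invariant Lie–Poisson structure on $V$ (that is, $\pi:\wedge^2V^*\to V^*$ is a $\Gamma$-invariant Lie bracket on $V^*$), and for each $\gamma$ with $l(\gamma)=2$ let $\pi_\gamma$ be the projection of $\pi$ onto $(V^\gamma)^*\otimes\wedge^2N^\gamma$ with respect to the decompositions $V=V^\gamma\oplus N^\gamma$ and $V^*=(V^\gamma)^*\oplus(N^\gamma)^*$. Let $c_\gamma\in\mathbb R$ satisfy $c_{\alpha\gamma\alpha^{-1}}=c_\gamma$ for all $\alpha,\gamma\in\Gamma$. Then $$\Pi=\pi+\sum_{l(\gamma)=2}c_\gamma\pi_\gamma ,$$ with $\pi$ as the component at the identity of $\Gamma$ and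 $c_\gamma\pi_\gamma$ as the component at $\gamma$, is a linear Poisson structure on the crossed product algebra $A=S(V^*)\rtimes\Gamma$. That is: $\Pi$ lies in $(V^*\otimes\wedge^2V)^\Gamma\oplus\big(\bigoplus_{l(\gamma)=2}(V^\gamma)^*\otimes\wedge^2N^\gamma\big)^\Gamma$; and the class in the Hochschild cohomology $HH^2(A,A)$ which it defines, namely the class of any $\mathbb R\Gamma$-relative Hochschild $2$-cocycle $f$ with $f(x,y)-f(y,x)=\sum_{\gamma}\Pi_\gamma(x,y)\gamma$ for all $x,y\in V^*$ (such an $f$ exists), satisfies $[\Pi,\Pi]=0$ in $HH^3(A,A)$ for the Gerstenhaber bracket. Here $f$ is $\mathbb R\Gamma$-relative if $f(ga,b)=gf(a,b)$, $f(ag,b)=f(a,gb)$ and $f(a,bg)=f(a,b)g$ for all $g\in\Gamma$ and $a,b\in A$. -/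

import Mathlib

namespace CrossedPoisson

open scoped InnerProductSpace

noncomputable section

universe u v

/-! ### Hochschild cochains of degree two and three and the Gerstenhaber bracket -/

section Hochschild

variable {A : Type*} [Ring A] [Algebra ℝ A]

/-- Hochschild 2-cochains of `A` with values in `A`: bilinear maps `A × A → A`. -/
abbrev TwoCochain (A : Type*) [Ring A] [Algebra ℝ A] : Type _ := A →ₗ[ℝ] A →ₗ[ℝ] A

/-- The Hochschild differential of a 2-cochain. -/
def hochschildD (f : TwoCochain A) (a b c : A) : A :=
  a * f b c - f (a * b) c + f a (b * c) - f a b * c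

/-- The Gerstenhaber circle product of two 2-cochains. -/
def circ (f g : TwoCochain A) (a b c : A) : A := f (g a b) c - f a (g b c)

/-- The Gerstenhaber bracket of two 2-cochains, a 3-cochain (2-cochains have odd degree for the
Gerstenhaber Lie structure, so the bracket is symmetric). -/
def gerstenhaberBracket (f g : TwoCochain A) (a b c : A) : A := circ f g a b c + circ g f a b c

/-- `f` is a Hochschild 2-cocycle. -/
def IsTwoCocycle (f : TwoCochain A) : Prop := ∀ a b c, hochschildD f a b c = 0

/-- The 3-cochain `t` is a Hochschild coboundary, that is, it vanishes in `HH³(A, A)`. -/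
def IsThreeCoboundary (t : A → A → A → A) : Prop :=
  ∃ h : TwoCochain A, ∀ a b c, t a b c = hochschildD h a b c

end Hochschild

/-! ### The crossed product `S(V*) ⋊ Γ` -/

section CrossedProduct

variable {Γ : Type u} [Group Γ] {V : Type v} [AddCommGroup V] [Module ℝ V]

/-- The symmetric algebra `S(V*)` of the dual of `V`, on which `Γ` acts through `ρ`. -/
def PolyAlg (_ρ : Representation ℝ Γ V) : Type v := SymmetricAlgebra ℝ (Module.Dual ℝ V)

variable (ρ : Representation ℝ Γ V)

instance : CommRing (PolyAlg ρ) :=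
  inferInstanceAs (CommRing (SymmetricAlgebra ℝ (Module.Dual ℝ V)))

instance : Algebra ℝ (PolyAlg ρ) :=
  inferInstanceAs (Algebra ℝ (SymmetricAlgebra ℝ (Module.Dual ℝ V)))

/-- The inclusion `V* → S(V*)`. -/
def polyι : Module.Dual ℝ V →ₗ[ℝ] PolyAlg ρ := SymmetricAlgebra.ι ℝ (Module.Dual ℝ V)

/-- The action of `g` on `S(V*)`, the algebra map extending the contragredient action on `V*`. -/
def polyAct (g : Γ) : PolyAlg ρ →ₐ[ℝ] PolyAlg ρ :=
  SymmetricAlgebra.lift (A := PolyAlg ρ) (polyι ρ ∘ₗ ρ.dual g)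

theorem polyAct_ι (g : Γ) (x : Module.Dual ℝ V) :
    polyAct ρ g (polyι ρ x) = polyι ρ (ρ.dual g x) :=
  SymmetricAlgebra.lift_ι_apply (A := PolyAlg ρ) (polyι ρ ∘ₗ ρ.dual g) x

theorem polyAlg_hom_ext {F G : PolyAlg ρ →ₐ[ℝ] PolyAlg ρ}
    (h : ∀ x, F (polyι ρ x) = G (polyι ρ x)) : F = G :=
  SymmetricAlgebra.algHom_ext (A := PolyAlg ρ) (LinearMap.ext h)

theorem polyAct_one : polyAct ρ 1 = AlgHom.id ℝ (PolyAlg ρ) :=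
  polyAlg_hom_ext ρ fun x => by rw [polyAct_ι, map_one]; rfl

theorem polyAct_mul (g h : Γ) : polyAct ρ (g * h) = (polyAct ρ g).comp (polyAct ρ h) :=
  polyAlg_hom_ext ρ fun x => by
    rw [AlgHom.comp_apply, polyAct_ι, polyAct_ι, polyAct_ι, map_mul]; rfl

instance : MulSemiringAction Γ (PolyAlg ρ) where
  smul g a := polyAct ρ g a
  one_smul a := congrArg (fun F : PolyAlg ρ →ₐ[ℝ] PolyAlg ρ => F a) (polyAct_one ρ)
  mul_smul g h a := congrArg (fun F : PolyAlg ρ →ₐ[ℝ] PolyAlg ρ => F a) (polyAct_mul ρ g h)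
  smul_zero g := map_zero (polyAct ρ g)
  smul_add g := map_add (polyAct ρ g)
  smul_one g := map_one (polyAct ρ g)
  smul_mul g := map_mul (polyAct ρ g)

theorem smul_def (g : Γ) (a : PolyAlg ρ) : g • a = polyAct ρ g a := rfl

instance : SMulCommClass Γ ℝ (PolyAlg ρ) where
  smul_comm g r a := map_smul (polyAct ρ g) r a

/-- The crossed product algebra `S(V*) ⋊ Γ`; `SkewMonoidAlgebra.single g a` is the element `a g`,
and `(a g) (b h) = a (g • b) (g h)`. -/
abbrev Crossed : Type (max u v) := SkewMonoidAlgebra (PolyAlg ρ) Γ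

/-- The element `x` of `V*`, viewed in `S(V*) ⋊ Γ`. -/
def lin (x : Module.Dual ℝ V) : Crossed ρ := SkewMonoidAlgebra.single 1 (polyι ρ x)

/-- The element `g` of `Γ`, viewed in `S(V*) ⋊ Γ`. -/
def grp (g : Γ) : Crossed ρ := SkewMonoidAlgebra.single g 1

end CrossedProduct

/-! ### Linear bivectors -/

/-- Bilinear maps `V* × V* → V*`; the alternating ones are the elements of `V* ⊗ ⋀² V`, that is, the
linear bivector fields on `V`. -/
abbrev LinBivector (V : Type v) [AddCommGroup V] [Module ℝ V] : Type v :=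
  Module.Dual ℝ V →ₗ[ℝ] Module.Dual ℝ V →ₗ[ℝ] Module.Dual ℝ V

section Bivector

variable {Γ : Type u} [Group Γ] {V : Type v} [AddCommGroup V] [Module ℝ V]

/-- `π` is a Lie-Poisson structure on `V`: a linear bivector field whose bracket
of linear functions satisfies the Jacobi identity, so that `V*` is a Lie algebra. -/
structure IsLiePoisson (π : LinBivector V) : Prop where
  alt : ∀ x, π x x = 0
  jacobi : ∀ x y z, π (π x y) z + π (π y z) x + π (π z x) y = 0

/-- `π` is invariant under `Γ`. -/
def IsInvariant (ρ : Representation ℝ Γ V) (π : LinBivector V) : Prop :=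
  ∀ g x y, π (ρ.dual g x) (ρ.dual g y) = ρ.dual g (π x y)

end Bivector

/-! ### Fixed subspaces, linear cocycles, linear Poisson structures -/

section Euclidean

variable {Γ : Type u} [Group Γ]
  {V : Type v} [NormedAddCommGroup V] [InnerProductSpace ℝ V] [FiniteDimensional ℝ V]
  (ρ : Representation ℝ Γ V)

/-- The subspace `V^γ` of vectors fixed by `γ`. -/
def fixedSpace (γ : Γ) : Submodule ℝ V := LinearMap.ker (ρ γ - LinearMap.id)

/-- The orthogonal complement `N^γ` of `V^γ`. -/
def normalSpace (γ : Γ) : Submodule ℝ V := (fixedSpace ρ γ)ᗮ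

/-- The codimension `l(γ)` of `V^γ`. -/
def codim (γ : Γ) : ℕ := Module.finrank ℝ (normalSpace ρ γ)

/-- Restriction of linear forms along the orthogonal projection onto `V^γ`: the projection of
`V* = (V^γ)* ⊕ (N^γ)*` onto `(V^γ)*`. -/
def toFixedDual (γ : Γ) : Module.Dual ℝ V →ₗ[ℝ] Module.Dual ℝ V :=
  Module.Dual.transpose (R := ℝ) ((fixedSpace ρ γ).starProjection : V →L[ℝ] V).toLinearMap

/-- The projection of `V* = (V^γ)* ⊕ (N^γ)*` onto `(N^γ)*`. -/
def toNormalDual (γ : Γ) : Module.Dual ℝ V →ₗ[ℝ] Module.Dual ℝ V :=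
  Module.Dual.transpose (R := ℝ) ((normalSpace ρ γ).starProjection : V →L[ℝ] V).toLinearMap

/-- The projection `π_γ` of `π ∈ V* ⊗ ⋀² V` onto `(V^γ)* ⊗ ⋀² N^γ`, given by
`π_γ (x, y) = π (x|_{N^γ}, y|_{N^γ})|_{V^γ}`. -/
def proj (π : LinBivector V) (γ : Γ) : LinBivector V :=
  (π.compl₁₂ (toNormalDual ρ γ) (toNormalDual ρ γ)).compr₂ (toFixedDual ρ γ)

/-- The family `Π = (Π_γ)` of bilinear maps `V* × V* → V*` is a linear cocycle, that is, it lies in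
`(V* ⊗ ⋀² V)^Γ ⊕ (⨁_{l(γ) = 2} (V^γ)* ⊗ ⋀² N^γ)^Γ`. The first summand is the component of the
identity. Elements of `(V^γ)*` are the linear forms that vanish on `N^γ`, and `⋀² N^γ` consists of
the alternating forms on `V*` that vanish as soon as one argument lies in `(V^γ)*`. -/
structure IsLinearCocycle (P : Γ → LinBivector V) : Prop where
  alt : ∀ γ x, P γ x x = 0
  equivariant : ∀ g γ x y,
    ρ.dual g (P γ (ρ.dual g⁻¹ x) (ρ.dual g⁻¹ y)) = P (g * γ * g⁻¹) x y
  support : ∀ γ, γ ≠ 1 → codim ρ γ ≠ 2 → P γ = 0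
  value : ∀ γ, codim ρ γ = 2 → ∀ x y, ∀ v ∈ normalSpace ρ γ, P γ x y v = 0
  normal : ∀ γ, codim ρ γ = 2 → ∀ x y, (∀ v ∈ normalSpace ρ γ, x v = 0) → P γ x y = 0

/-- The Hochschild 2-cocycle `f` of `S(V*) ⋊ Γ` represents the Koszul cochain
`x ∧ y ↦ ∑ γ, Π_γ (x, y) γ`. Here `f` is taken relative to `ℝΓ`, and the restriction to the Koszul
complex is along `x ∧ y ↦ x ⊗ y - y ⊗ x`. As restriction from the `ℝΓ`-relative Hochschild complex
to the Koszul complex is a quasi-isomorphism, this condition determines the class of `f` in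
`HH²(S(V*) ⋊ Γ, S(V*) ⋊ Γ)`. -/
structure Represents [Fintype Γ] (f : TwoCochain (Crossed ρ)) (P : Γ → LinBivector V) : Prop where
  cocycle : IsTwoCocycle f
  left : ∀ g a b, f (grp ρ g * a) b = grp ρ g * f a b
  middle : ∀ g a b, f (a * grp ρ g) b = f a (grp ρ g * b)
  right : ∀ g a b, f a (b * grp ρ g) = f a b * grp ρ g
  koszul : ∀ x y : Module.Dual ℝ V, f (lin ρ x) (lin ρ y) - f (lin ρ y) (lin ρ x) =
    ∑ γ, lin ρ (P γ x y) * grp ρ γ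

/-- `Π` is a linear Poisson structure on `S(V*) ⋊ Γ`: it is a linear cocycle, and the Gerstenhaber
bracket of its class in `HH²(S(V*) ⋊ Γ, S(V*) ⋊ Γ)` with itself is zero in
`HH³(S(V*) ⋊ Γ, S(V*) ⋊ Γ)`. -/
structure IsLinearPoisson [Fintype Γ] (P : Γ → LinBivector V) : Prop where
  linearCocycle : IsLinearCocycle ρ P
  bracket : ∃ f : TwoCochain (Crossed ρ), Represents ρ f P ∧
    IsThreeCoboundary (gerstenhaberBracket f f)

open Classical in
/-- The family `Π = π + ∑_{l(γ) = 2} c_γ π_γ`, with `π` at the identity and `c_γ π_γ` at `γ`. -/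
def twisted (π : LinBivector V) (c : Γ → ℝ) (γ : Γ) : LinBivector V :=
  (if γ = 1 then π else 0) + (if codim ρ γ = 2 then c γ • proj ρ π γ else 0)

end Euclidean

end

end CrossedPoisson

open CrossedPoisson

/-! The bracket `[Π, Π]` vanishes because `Π` is the first order part of an associative deformation
of `A = S(V*) ⋊ Γ` modulo `t³`. If the product is `ab + t f(a, b) + t² h(a, b)`, associativity at
order `t` says that `f` is a cocycle, and at order `t²` that `f ∘ f = dh`; hence `[f, f] = d(2h)`.

The deformation is realised by operators `L x = x + α(x) t + β(x) t²` on `A[t]/t³`, where `x` acts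
by left multiplication, subject to `[L x, L y] = t ∑ L(Π_γ(x, y)) γ - t² ∑ κ_γ(x, y) γ` with scalars
`κ_γ(x, y)`. Since the `L x` commute modulo `t`, the universal property of `A` shows that every
operator in the algebra generated by `t`, the `L x` and `Γ` whose constant term vanishes is
divisible by `t`. Evaluation at `1` is therefore a bijection from that algebra onto `A[t]/t³`
(`exists_opAlg_equiv`), and it transports the product.

The conditions on `α` and `β` are Koszul equations in `End(A)`, with the commutators by `V*` as
differential. That complex computes Ext over `S(V*)` of the free module `A` with itself, so closed
two-forms have primitives (`exists_koszul_primitive`), and averaging makes these equivariant.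
Closedness of the two right-hand sides follows from two identities (`pairForm_mulLin_closed`,
`secondOrderForm_closed`): the cyclic sum of `Π_γ(x, y) ⊗ (γz - z)` is zero, and the Jacobi
expression of `Π` at `σ` is the cyclic sum of `κ_σ(x, y) (σz - z)`.

At `γ = 1` the first identity is trivial; elsewhere `Π_γ` is zero or `(p ∧ q) u`, with `γ - 1`
factoring through the two forms `p, q`, so a three-form in two variables appears. In the second, `π`
with itself gives the Jacobi identity, and `π` with `π_γ` cancels because the forms fixed by `γ` are
a subalgebra acting on the two-dimensional normal part (`mixed_cyclic_eq_zero`). Products of two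
components of codimension two are absorbed by `κ`: all factorisations of `σ` yield multiples of one
four-form, and exchanging the factors by a Hurwitz move, together with the Plücker relation, gives
an explicit `κ` (`exists_scalar_component`). -/

namespace CrossedPoisson

open scoped InnerProductSpace

noncomputable section

/-! ### Exactness of Koszul complexes of commuting operators with right inverses -/

/-- The Koszul complex of commuting operators `δ i` is exact in degree two, provided that the `δ i`
have right inverses `T i` such that `T j` commutes with `δ i` for `i ≠ j`. -/
theorem exists_koszul_primitive {ι X : Type*} [DecidableEq ι] [AddCommGroup X] (δ T : ι → X →+ X)
    (hδδ : ∀ i j x, δ i (δ j x) = δ j (δ i x)) (hδT : ∀ i x, δ i (T i x) = x)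
    (hδT' : ∀ i j, i ≠ j → ∀ x, δ i (T j x) = T j (δ i x))
    (R Z : AddSubgroup X) (hZR : Z ≤ R) (hR : ∀ i, ∀ x ∈ R, δ i x ∈ R)
    (hT : ∀ i, ∀ x ∈ R, T i x ∈ Z) (s : Finset ι) :
    ∀ ω : ι → ι → X, (∀ i, ω i i = 0) → (∀ i j, ω i j = -ω j i) → (∀ i j, ω i j ∈ R) →
      (∀ i j k, δ i (ω j k) + δ j (ω k i) + δ k (ω i j) = 0) → (∀ i, i ∉ s → ∀ j, ω i j = 0) →
      (∀ k, k ∉ s → ∀ i j, δ k (ω i j) = 0) →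
      ∃ α : ι → X, (∀ i, α i ∈ Z) ∧ ∀ i j, δ i (α j) - δ j (α i) = ω i j := by
  induction s using Finset.induction_on with
  | empty =>
    intro ω _ _ _ _ h _
    exact ⟨fun _ => 0, fun _ => Z.zero_mem, fun i j => by simp [h]⟩
  | insert n s hn ih =>
    intro ω hd ha hm hc hs hk
    -- Integrating in the direction `n` alone already gives the components `ω n j`. What remains has
    -- no component along `n` and, by closedness, is killed by `δ n`, so the induction hypothesis
    -- for `s` applies.
    set α : ι → X := fun i => T n (ω n i) with hα
    have hαZ : ∀ i, α i ∈ Z := fun i => hT n _ (hm n i)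
    have hαn : α n = 0 := by simp [hα, hd]
    have h1 : ∀ j, δ n (α j) - δ j (α n) = ω n j := fun j => by
      rw [hαn, map_zero, sub_zero]; exact hδT n _
    have key := ih (fun i j => ω i j - (δ i (α j) - δ j (α i)))
      (fun i => by simp [hd])
      (fun i j => by simp only [ha i j]; abel)
      (fun i j => R.sub_mem (hm i j) (R.sub_mem (hR i _ (hZR (hαZ j))) (hR j _ (hZR (hαZ i)))))
    refine Exists.elim (key ?_ ?_ ?_) ?_
    rotate_right
    · rintro β ⟨hβZ, hβ⟩
      refine ⟨fun i => α i + β i, fun i => Z.add_mem (hαZ i) (hβZ i), fun i j => ?_⟩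
      have := hβ i j
      simp only [map_add]
      rw [← sub_eq_zero] at this ⊢
      rw [← this]
      abel
    · intro i j k
      have := hc i j k
      simp only [map_sub, hδδ j i, hδδ k i, hδδ k j]
      rw [← this]
      abel
    · intro i hi j
      by_cases hin : i = n
      · subst hin
        simp only [h1, sub_self]
      · have hi' : i ∉ insert n s := by simp [hin, hi]
        simp only [hα, hs i hi', hδT' i n hin, hk i hi', ha n i, map_zero, neg_zero,
          sub_zero]
    · intro k hks i j
      by_cases hkn : k = n
      · subst hkn
        -- Here `k = n`. Closedness for `(n, i, j)`, with `ω n j` and `ω n i` replaced by `δ n (α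
        -- j)` and `δ n (α i)`, says that `δ n` kills the remainder.
        have hi : ω i k - (δ i (α k) - δ k (α i)) = 0 := by
          have := h1 i
          rw [ha i k, ← this]; abel
        have hc1 := hc k i j
        have e1 : ω k j = δ k (α j) - δ j (α k) := (h1 j).symm
        have e2 : ω k i = δ k (α i) - δ i (α k) := (h1 i).symm
        rw [ha j k, e1, e2, hαn] at hc1
        simp only [map_zero, sub_zero, map_neg] at hc1
        simp only [map_sub]
        rw [hδδ k i, hδδ k j, ← hc1, hδδ j k, hδδ i k]
        abel
      · have hk' : k ∉ insert n s := by simp [hkn, hks]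
        simp only [hα, map_sub, hk k hk']
        rw [hδδ k i, hδδ k j, hδT' k n hkn, hδT' k n hkn, hk k hk', hk k hk']
        simp

section CrossedProduct

variable {Γ : Type*} [Group Γ] {V : Type*} [AddCommGroup V] [Module ℝ V]
  (ρ : Representation ℝ Γ V)

/-! ### Monomials in the crossed product -/

theorem lin_add (x y : Module.Dual ℝ V) : lin ρ (x + y) = lin ρ x + lin ρ y := by
  simp [lin, SkewMonoidAlgebra.single_add]

theorem lin_smul (r : ℝ) (x : Module.Dual ℝ V) : lin ρ (r • x) = r • lin ρ x := by
  simp [lin, SkewMonoidAlgebra.smul_single]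

theorem grp_one : grp ρ 1 = 1 := rfl

theorem grp_mul (g h : Γ) : grp ρ (g * h) = grp ρ g * grp ρ h := by
  simp [grp, SkewMonoidAlgebra.single_mul_single]

theorem grp_mul_lin (g : Γ) (x : Module.Dual ℝ V) :
    grp ρ g * lin ρ x = lin ρ (ρ.dual g x) * grp ρ g := by
  simp [grp, lin, SkewMonoidAlgebra.single_mul_single, smul_def, polyAct_ι]

theorem lin_mul_comm (x y : Module.Dual ℝ V) : lin ρ x * lin ρ y = lin ρ y * lin ρ x := by
  simp [lin, SkewMonoidAlgebra.single_mul_single, mul_comm]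

/-- The monomial basis of the crossed product. -/
def monomialBasis {ι : Type*} (b : Module.Basis ι ℝ (Module.Dual ℝ V)) :
    Module.Basis (Σ _ : Γ, ι →₀ ℕ) ℝ (Crossed ρ) :=
  (Finsupp.basis fun _ : Γ => (show Module.Basis (ι →₀ ℕ) ℝ (PolyAlg ρ) from
    b.symmetricAlgebra)).map SkewMonoidAlgebra.coeffLinearEquiv.symm

theorem monomialBasis_apply {ι : Type*} (b : Module.Basis ι ℝ (Module.Dual ℝ V)) (g : Γ)
    (m : ι →₀ ℕ) : monomialBasis ρ b ⟨g, m⟩ =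
      SkewMonoidAlgebra.single g (show PolyAlg ρ from b.symmetricAlgebra m) := by
  rw [monomialBasis, Module.Basis.map_apply]
  exact congrArg SkewMonoidAlgebra.coeffLinearEquiv.symm
    (congrFun (Finsupp.coe_basis (R := ℝ) fun _ : Γ => (show Module.Basis (ι →₀ ℕ) ℝ (PolyAlg ρ) from
      b.symmetricAlgebra)) ⟨g, m⟩)

theorem lin_mul_monomialBasis {ι : Type*} (b : Module.Basis ι ℝ (Module.Dual ℝ V)) (i : ι) (g : Γ)
    (m : ι →₀ ℕ) : lin ρ (b i) * monomialBasis ρ b ⟨g, m⟩ =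
      monomialBasis ρ b ⟨g, m + Finsupp.single i 1⟩ := by
  rw [monomialBasis_apply, monomialBasis_apply, lin, SkewMonoidAlgebra.single_mul_single, one_mul,
    one_smul]
  congr 1
  have h : SymmetricAlgebra.ι ℝ (Module.Dual ℝ V) (b i) * b.symmetricAlgebra m =
      b.symmetricAlgebra (m + Finsupp.single i 1) := by
    apply (SymmetricAlgebra.equivMvPolynomial b).injective
    simp [Module.Basis.symmetricAlgebra, MvPolynomial.X, MvPolynomial.monomial_mul, add_comm]
  exact h

theorem monomialBasis_mul_grp {ι : Type*} (b : Module.Basis ι ℝ (Module.Dual ℝ V)) (g h : Γ)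
    (m : ι →₀ ℕ) : monomialBasis ρ b ⟨g, m⟩ * grp ρ h = monomialBasis ρ b ⟨g * h, m⟩ := by
  rw [monomialBasis_apply, monomialBasis_apply, grp, SkewMonoidAlgebra.single_mul_single, smul_one,
    mul_one]

theorem monomialBasis_zero {ι : Type*} (b : Module.Basis ι ℝ (Module.Dual ℝ V)) (g : Γ) :
    monomialBasis ρ b ⟨g, 0⟩ = grp ρ g := by
  rw [monomialBasis_apply, grp]
  congr 1
  have h : b.symmetricAlgebra 0 = (1 : SymmetricAlgebra ℝ (Module.Dual ℝ V)) := by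
    apply (SymmetricAlgebra.equivMvPolynomial b).injective
    simp [Module.Basis.symmetricAlgebra]
  exact h

/-! ### Operators on the crossed product -/

/-- Left multiplication by a linear form. -/
def mulLin : Module.Dual ℝ V →ₗ[ℝ] Module.End ℝ (Crossed ρ) where
  toFun x := LinearMap.mulLeft ℝ (lin ρ x)
  map_add' x y := by ext a; simp [lin_add, add_mul]
  map_smul' r x := by ext a; simp [lin_smul]

/-- Left multiplication by a group element. -/
def mulGrp (g : Γ) : Module.End ℝ (Crossed ρ) := LinearMap.mulLeft ℝ (grp ρ g)

theorem mulLin_apply (x : Module.Dual ℝ V) (a : Crossed ρ) : mulLin ρ x a = lin ρ x * a := rfl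

theorem mulGrp_apply (g : Γ) (a : Crossed ρ) : mulGrp ρ g a = grp ρ g * a := rfl

theorem mulLin_comm (x y : Module.Dual ℝ V) : mulLin ρ x * mulLin ρ y = mulLin ρ y * mulLin ρ x :=
  LinearMap.ext fun a => by
    simp only [Module.End.mul_apply, mulLin_apply, ← mul_assoc, lin_mul_comm ρ x y]

theorem mulGrp_one : mulGrp ρ 1 = 1 := LinearMap.ext fun a => by simp [mulGrp_apply, grp_one]

theorem mulGrp_mul (g h : Γ) : mulGrp ρ (g * h) = mulGrp ρ g * mulGrp ρ h :=
  LinearMap.ext fun a => by simp [mulGrp_apply, grp_mul, mul_assoc]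

theorem mulGrp_mul_mulLin (g : Γ) (x : Module.Dual ℝ V) :
    mulGrp ρ g * mulLin ρ x = mulLin ρ (ρ.dual g x) * mulGrp ρ g :=
  LinearMap.ext fun a => by
    simp only [Module.End.mul_apply, mulGrp_apply, mulLin_apply, ← mul_assoc, grp_mul_lin]

/-- The operators that commute with right multiplication by the group. -/
def rightLinear : Subalgebra ℝ (Module.End ℝ (Crossed ρ)) :=
  Subalgebra.centralizer ℝ (Set.range fun g : Γ => LinearMap.mulRight ℝ (grp ρ g))

theorem mem_rightLinear {φ : Module.End ℝ (Crossed ρ)} :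
    φ ∈ rightLinear ρ ↔ ∀ a g, φ (a * grp ρ g) = φ a * grp ρ g := by
  simp only [rightLinear, Subalgebra.mem_centralizer_iff, Set.forall_mem_range, LinearMap.ext_iff,
    Module.End.mul_apply, LinearMap.mulRight_apply]
  exact ⟨fun h a g => (h g a).symm, fun h g a => (h a g).symm⟩

theorem mulLin_mem_rightLinear (x : Module.Dual ℝ V) : mulLin ρ x ∈ rightLinear ρ :=
  (mem_rightLinear ρ).2 fun a g => by simp only [mulLin_apply, mul_assoc]

theorem mulGrp_mem_rightLinear (g : Γ) : mulGrp ρ g ∈ rightLinear ρ :=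
  (mem_rightLinear ρ).2 fun a g => by simp only [mulGrp_apply, mul_assoc]

/-- The commutator with left multiplication by a linear form. -/
def commLin (x : Module.Dual ℝ V) : Module.End ℝ (Crossed ρ) →+ Module.End ℝ (Crossed ρ) where
  toFun φ := mulLin ρ x * φ - φ * mulLin ρ x
  map_zero' := by simp
  map_add' φ ψ := by simp only [mul_add, add_mul]; abel

theorem commLin_apply (x : Module.Dual ℝ V) (φ : Module.End ℝ (Crossed ρ)) :
    commLin ρ x φ = mulLin ρ x * φ - φ * mulLin ρ x := rfl

theorem commLin_comm (x y : Module.Dual ℝ V) (φ : Module.End ℝ (Crossed ρ)) :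
    commLin ρ x (commLin ρ y φ) = commLin ρ y (commLin ρ x φ) := by
  have h := mulLin_comm ρ x y
  have h1 : mulLin ρ x * (mulLin ρ y * φ) = mulLin ρ y * (mulLin ρ x * φ) := by
    rw [← mul_assoc, h, mul_assoc]
  have h2 : φ * mulLin ρ y * mulLin ρ x = φ * mulLin ρ x * mulLin ρ y := by
    rw [mul_assoc, ← h, ← mul_assoc]
  simp only [commLin_apply, mul_sub, sub_mul, h1, h2, mul_assoc]
  abel

/-- A right inverse of the commutator with left multiplication by a basis vector. -/
def commLinInv {ι : Type*} [DecidableEq ι] (b : Module.Basis ι ℝ (Module.Dual ℝ V)) (k : ι) :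
    Module.End ℝ (Crossed ρ) →+ Module.End ℝ (Crossed ρ) where
  -- The sum is the solution of `ψ(x_k m) = x_k ψ(m) - φ(m)` with `ψ = 0` on monomials free of
  -- `x_k`. Since `e < p.2 k` in the range, the natural subtraction does not truncate.
  toFun φ := (monomialBasis ρ b).constr ℝ fun p =>
    -∑ e ∈ Finset.range (p.2 k), (mulLin ρ (b k) ^ (p.2 k - 1 - e))
      (φ (monomialBasis ρ b ⟨p.1, p.2.update k e⟩))
  map_zero' := (monomialBasis ρ b).ext fun p => by
    simp only [Module.Basis.constr_basis, LinearMap.zero_apply, map_zero, Finset.sum_const_zero,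
      neg_zero]
  map_add' φ ψ := (monomialBasis ρ b).ext fun p => by
    simp only [Module.Basis.constr_basis, LinearMap.add_apply, map_add, Finset.sum_add_distrib,
      neg_add]

theorem commLinInv_apply {ι : Type*} [DecidableEq ι] (b : Module.Basis ι ℝ (Module.Dual ℝ V))
    (k : ι) (φ : Module.End ℝ (Crossed ρ)) (g : Γ) (m : ι →₀ ℕ) :
    commLinInv ρ b k φ (monomialBasis ρ b ⟨g, m⟩) =
      -∑ e ∈ Finset.range (m k), (mulLin ρ (b k) ^ (m k - 1 - e))
        (φ (monomialBasis ρ b ⟨g, m.update k e⟩)) :=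
  (monomialBasis ρ b).constr_basis ℝ _ _

/-- The sum telescopes: multiplying the monomial by `b k` adds the term `e = m k`, and all other
terms cancel against left multiplication by `b k`. -/
theorem commLin_commLinInv {ι : Type*} [DecidableEq ι] (b : Module.Basis ι ℝ (Module.Dual ℝ V))
    (k : ι) (φ : Module.End ℝ (Crossed ρ)) : commLin ρ (b k) (commLinInv ρ b k φ) = φ := by
  refine (monomialBasis ρ b).ext fun ⟨g, m⟩ => ?_
  rw [commLin_apply, LinearMap.sub_apply, Module.End.mul_apply, Module.End.mul_apply,
    mulLin_apply ρ _ (monomialBasis ρ b _), lin_mul_monomialBasis, commLinInv_apply,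
    commLinInv_apply]
  have hu : ∀ e, (m + Finsupp.single k 1).update k e = m.update k e := fun e => by
    ext j
    by_cases h : j = k
    · subst h; simp
    · simp [Function.update_of_ne h, Finsupp.single_eq_of_ne h]
  have hk : (m + Finsupp.single k 1 : ι →₀ ℕ) k = m k + 1 := by simp
  rw [hk, Finset.sum_range_succ]
  simp only [hu, map_neg, map_sum, Finsupp.update_self, Nat.add_sub_cancel, Nat.sub_self, pow_zero,
    Module.End.one_apply]
  have : ∀ e ∈ Finset.range (m k), mulLin ρ (b k) ((mulLin ρ (b k) ^ (m k - 1 - e))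
        (φ (monomialBasis ρ b ⟨g, m.update k e⟩))) =
      (mulLin ρ (b k) ^ (m k - e)) (φ (monomialBasis ρ b ⟨g, m.update k e⟩)) := fun e he => by
    rw [← Module.End.mul_apply, ← pow_succ']
    congr 2
    have := Finset.mem_range.1 he
    omega
  rw [Finset.sum_congr rfl this]
  abel

theorem commLin_commLinInv_of_ne {ι : Type*} [DecidableEq ι]
    (b : Module.Basis ι ℝ (Module.Dual ℝ V)) {i k : ι} (hik : i ≠ k)
    (φ : Module.End ℝ (Crossed ρ)) :
    commLin ρ (b i) (commLinInv ρ b k φ) = commLinInv ρ b k (commLin ρ (b i) φ) := by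
  refine (monomialBasis ρ b).ext fun ⟨g, m⟩ => ?_
  rw [commLin_apply, LinearMap.sub_apply, Module.End.mul_apply, Module.End.mul_apply,
    mulLin_apply ρ _ (monomialBasis ρ b _), lin_mul_monomialBasis, commLinInv_apply,
    commLinInv_apply, commLinInv_apply]
  have hu : ∀ e, (m + Finsupp.single i 1).update k e = m.update k e + Finsupp.single i 1 :=
    fun e => by
      ext j
      by_cases h : j = k
      · subst h; simp [Finsupp.single_eq_of_ne hik.symm]
      · simp [Function.update_of_ne h]
  have hk : (m + Finsupp.single i 1 : ι →₀ ℕ) k = m k := by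
    simp [Finsupp.single_eq_of_ne hik.symm]
  rw [hk, map_neg, map_sum, sub_neg_eq_add, neg_add_eq_sub, ← Finset.sum_sub_distrib,
    ← Finset.sum_neg_distrib]
  refine Finset.sum_congr rfl fun e _ => ?_
  have hc : mulLin ρ (b i) * mulLin ρ (b k) ^ (m k - 1 - e) =
      mulLin ρ (b k) ^ (m k - 1 - e) * mulLin ρ (b i) :=
    ((show Commute _ _ from mulLin_comm ρ (b i) (b k)).pow_right _).eq
  rw [hu, commLin_apply, LinearMap.sub_apply, Module.End.mul_apply, Module.End.mul_apply,
    mulLin_apply ρ _ (monomialBasis ρ b _), lin_mul_monomialBasis, map_sub]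
  have := LinearMap.congr_fun hc (φ (monomialBasis ρ b ⟨g, m.update k e⟩))
  rw [Module.End.mul_apply, Module.End.mul_apply] at this
  rw [this]
  abel

theorem commLinInv_mem_rightLinear {ι : Type*} [DecidableEq ι]
    (b : Module.Basis ι ℝ (Module.Dual ℝ V)) (k : ι) {φ : Module.End ℝ (Crossed ρ)}
    (hφ : φ ∈ rightLinear ρ) : commLinInv ρ b k φ ∈ rightLinear ρ := by
  refine (mem_rightLinear ρ).2 fun a h => ?_
  suffices (commLinInv ρ b k φ) ∘ₗ LinearMap.mulRight ℝ (grp ρ h) =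
      LinearMap.mulRight ℝ (grp ρ h) ∘ₗ commLinInv ρ b k φ from LinearMap.congr_fun this a
  refine (monomialBasis ρ b).ext fun ⟨g, m⟩ => ?_
  have hp : ∀ n c, (mulLin ρ (b k) ^ n) (c * grp ρ h) = (mulLin ρ (b k) ^ n) c * grp ρ h :=
    fun n c => (mem_rightLinear ρ).1 (pow_mem (mulLin_mem_rightLinear ρ (b k)) n) c h
  simp only [LinearMap.comp_apply, LinearMap.mulRight_apply, monomialBasis_mul_grp,
    commLinInv_apply, neg_mul, Finset.sum_mul, ← hp]
  simp only [← (mem_rightLinear ρ).1 hφ, monomialBasis_mul_grp]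

/-- The sum is empty on monomials of degree zero. This is the source of the normalisation `α x 1 =
0`. -/
theorem commLinInv_grp {ι : Type*} [DecidableEq ι] (b : Module.Basis ι ℝ (Module.Dual ℝ V))
    (k : ι) (φ : Module.End ℝ (Crossed ρ)) (g : Γ) : commLinInv ρ b k φ (grp ρ g) = 0 := by
  rw [← monomialBasis_zero ρ b, commLinInv_apply]
  simp

end CrossedProduct
end
end CrossedPoisson

namespace CrossedPoisson

open scoped InnerProductSpace

noncomputable section

section CrossedProduct

variable {Γ : Type*} [Group Γ] {V : Type*} [AddCommGroup V] [Module ℝ V]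
  (ρ : Representation ℝ Γ V)

/-! ### Primitives of closed two-forms with values in operators -/

/-- The Koszul differential of an operator valued one-form, as a bilinear map. -/
def koszulD (α : Module.Dual ℝ V →ₗ[ℝ] Module.End ℝ (Crossed ρ)) :
    Module.Dual ℝ V →ₗ[ℝ] Module.Dual ℝ V →ₗ[ℝ] Module.End ℝ (Crossed ρ) :=
  LinearMap.mk₂ ℝ (fun x y => commLin ρ x (α y) - commLin ρ y (α x))
    (fun x x' y => by simp only [commLin_apply, map_add, mul_add, add_mul]; abel)
    (fun r x y => by
      simp only [commLin_apply, map_smul, smul_mul_assoc, mul_smul_comm, smul_sub])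
    (fun x y y' => by simp only [commLin_apply, map_add, mul_add, add_mul]; abel)
    (fun r x y => by
      simp only [commLin_apply, map_smul, smul_mul_assoc, mul_smul_comm, smul_sub])

theorem koszulD_apply (α : Module.Dual ℝ V →ₗ[ℝ] Module.End ℝ (Crossed ρ))
    (x y : Module.Dual ℝ V) : koszulD ρ α x y = commLin ρ x (α y) - commLin ρ y (α x) := rfl

/-- The abstract exactness in coordinates. `R` consists of the operators that commute with right
multiplication by the group, and `Z` of those that in addition vanish at `1`; the right inverses
send `R` into `Z`. -/
theorem exists_koszulD_eq [FiniteDimensional ℝ V]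
    (Ω : Module.Dual ℝ V →ₗ[ℝ] Module.Dual ℝ V →ₗ[ℝ] Module.End ℝ (Crossed ρ))
    (hd : ∀ x, Ω x x = 0) (hR : ∀ x y, Ω x y ∈ rightLinear ρ)
    (hc : ∀ x y z, commLin ρ x (Ω y z) + commLin ρ y (Ω z x) + commLin ρ z (Ω x y) = 0) :
    ∃ α : Module.Dual ℝ V →ₗ[ℝ] Module.End ℝ (Crossed ρ),
      (∀ x, α x ∈ rightLinear ρ) ∧ (∀ x, α x 1 = 0) ∧ koszulD ρ α = Ω := by
  classical
  let b := Module.finBasis ℝ (Module.Dual ℝ V)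
  let R : AddSubgroup (Module.End ℝ (Crossed ρ)) := (rightLinear ρ).toSubring.toAddSubgroup
  let Z : AddSubgroup (Module.End ℝ (Crossed ρ)) :=
    R ⊓ ((LinearMap.applyₗ (R := ℝ) (M₂ := Crossed ρ) (1 : Crossed ρ)).toAddMonoidHom.ker)
  have hRmem : ∀ φ, φ ∈ R ↔ φ ∈ rightLinear ρ := fun φ => Iff.rfl
  have hZmem : ∀ φ, φ ∈ Z ↔ φ ∈ rightLinear ρ ∧ φ 1 = 0 := fun φ => Iff.rfl
  obtain ⟨α, hαZ, hα⟩ := exists_koszul_primitive (fun i => commLin ρ (b i)) (commLinInv ρ b)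
    (fun i j φ => commLin_comm ρ _ _ φ) (commLin_commLinInv ρ b)
    (fun i j h φ => commLin_commLinInv_of_ne ρ b h φ) R Z inf_le_left
    (fun i φ hφ => by
      have hm := mulLin_mem_rightLinear ρ (b i)
      exact (hRmem _).2 (sub_mem (mul_mem hm ((hRmem φ).1 hφ)) (mul_mem ((hRmem φ).1 hφ) hm)))
    (fun i φ hφ => (hZmem _).2 ⟨commLinInv_mem_rightLinear ρ b i ((hRmem φ).1 hφ), by
      rw [← grp_one]; exact commLinInv_grp ρ b i φ 1⟩)
    Finset.univ (fun i j => Ω (b i) (b j)) (fun i => hd _)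
    (fun i j => by
      have := hd (b i + b j)
      simp only [map_add, LinearMap.add_apply, hd, zero_add, add_zero] at this
      exact eq_neg_of_add_eq_zero_right this)
    (fun i j => hR _ _) (fun i j k => hc _ _ _) (fun i hi => absurd (Finset.mem_univ i) hi)
    (fun i hi => absurd (Finset.mem_univ i) hi)
  have hspan : ∀ x, b.constr ℝ α x ∈ (Subalgebra.toSubmodule (rightLinear ρ)) ⊓
      LinearMap.ker (LinearMap.applyₗ (R := ℝ) (M₂ := Crossed ρ) (1 : Crossed ρ)) := by
    intro x
    rw [Module.Basis.constr_apply_fintype]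
    exact Submodule.sum_mem _ fun i _ => Submodule.smul_mem _ _ ((hZmem _).1 (hαZ i))
  refine ⟨b.constr ℝ α, fun x => (hspan x).1, fun x => (hspan x).2,
    LinearMap.ext_basis b b fun i j => ?_⟩
  rw [koszulD_apply, b.constr_basis, b.constr_basis]
  exact hα i j

theorem dual_inv_dual (g : Γ) (x : Module.Dual ℝ V) : ρ.dual g⁻¹ (ρ.dual g x) = x := by
  rw [← Module.End.mul_apply, ← map_mul, inv_mul_cancel, map_one, Module.End.one_apply]

theorem dual_dual_inv (g : Γ) (x : Module.Dual ℝ V) : ρ.dual g (ρ.dual g⁻¹ x) = x := by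
  rw [← Module.End.mul_apply, ← map_mul, mul_inv_cancel, map_one, Module.End.one_apply]

theorem dual_mul_apply (g h : Γ) (x : Module.Dual ℝ V) :
    ρ.dual (g * h) x = ρ.dual g (ρ.dual h x) := by
  rw [map_mul, Module.End.mul_apply]

theorem mulGrp_inv_mul (g : Γ) : mulGrp ρ g⁻¹ * mulGrp ρ g = 1 := by
  rw [← mulGrp_mul, inv_mul_cancel, mulGrp_one]

theorem mulGrp_mul_inv (g : Γ) : mulGrp ρ g * mulGrp ρ g⁻¹ = 1 := by
  rw [← mulGrp_mul, mul_inv_cancel, mulGrp_one]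

/-- Conjugation of an operator valued one-form by a group element. -/
def conjForm (g : Γ) (α : Module.Dual ℝ V →ₗ[ℝ] Module.End ℝ (Crossed ρ)) :
    Module.Dual ℝ V →ₗ[ℝ] Module.End ℝ (Crossed ρ) :=
  LinearMap.mulRight ℝ (mulGrp ρ g⁻¹) ∘ₗ LinearMap.mulLeft ℝ (mulGrp ρ g) ∘ₗ α ∘ₗ ρ.dual g⁻¹

theorem conjForm_apply (g : Γ) (α : Module.Dual ℝ V →ₗ[ℝ] Module.End ℝ (Crossed ρ))
    (x : Module.Dual ℝ V) :
    conjForm ρ g α x = mulGrp ρ g * α (ρ.dual g⁻¹ x) * mulGrp ρ g⁻¹ := rfl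

theorem commLin_conj (g : Γ) (x : Module.Dual ℝ V) (φ : Module.End ℝ (Crossed ρ)) :
    commLin ρ x (mulGrp ρ g * φ * mulGrp ρ g⁻¹) =
      mulGrp ρ g * commLin ρ (ρ.dual g⁻¹ x) φ * mulGrp ρ g⁻¹ := by
  have h1 : mulGrp ρ g * mulLin ρ (ρ.dual g⁻¹ x) = mulLin ρ x * mulGrp ρ g := by
    rw [mulGrp_mul_mulLin, dual_dual_inv]
  have h2 : mulGrp ρ g⁻¹ * mulLin ρ x = mulLin ρ (ρ.dual g⁻¹ x) * mulGrp ρ g⁻¹ :=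
    mulGrp_mul_mulLin ρ _ _
  simp only [commLin_apply, mul_sub, sub_mul, mul_assoc, h2]
  simp only [← mul_assoc, h1]

theorem koszulD_conjForm (g : Γ) (α : Module.Dual ℝ V →ₗ[ℝ] Module.End ℝ (Crossed ρ))
    (x y : Module.Dual ℝ V) : koszulD ρ (conjForm ρ g α) x y =
      mulGrp ρ g * koszulD ρ α (ρ.dual g⁻¹ x) (ρ.dual g⁻¹ y) * mulGrp ρ g⁻¹ := by
  simp only [koszulD_apply, conjForm_apply, commLin_conj, mul_sub, sub_mul]

/-- A closed equivariant operator valued two-form has an equivariant primitive that vanishes at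
the unit of the crossed product. -/
theorem exists_equivariant_koszulD_eq [Fintype Γ] [FiniteDimensional ℝ V]
    (Ω : Module.Dual ℝ V →ₗ[ℝ] Module.Dual ℝ V →ₗ[ℝ] Module.End ℝ (Crossed ρ))
    (hd : ∀ x, Ω x x = 0) (hR : ∀ x y, Ω x y ∈ rightLinear ρ)
    (hc : ∀ x y z, commLin ρ x (Ω y z) + commLin ρ y (Ω z x) + commLin ρ z (Ω x y) = 0)
    (hE : ∀ g x y, mulGrp ρ g * Ω x y = Ω (ρ.dual g x) (ρ.dual g y) * mulGrp ρ g) :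
    ∃ α : Module.Dual ℝ V →ₗ[ℝ] Module.End ℝ (Crossed ρ),
      (∀ x, α x ∈ rightLinear ρ) ∧ (∀ x, α x 1 = 0) ∧
      (∀ g x, mulGrp ρ g * α x = α (ρ.dual g x) * mulGrp ρ g) ∧
      ∀ x y, commLin ρ x (α y) - commLin ρ y (α x) = Ω x y := by
  obtain ⟨α, hαR, hα1, hα⟩ := exists_koszulD_eq ρ Ω hd hR hc
  -- Right linearity extends the vanishing at `1` to the group, which is what conjugation needs in
  -- order to preserve the normalisation under averaging.
  have hαg : ∀ x g, α x (grp ρ g) = 0 := fun x g => by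
    have := (mem_rightLinear ρ).1 (hαR x) 1 g
    rwa [one_mul, hα1, zero_mul] at this
  set β : Module.Dual ℝ V →ₗ[ℝ] Module.End ℝ (Crossed ρ) :=
    (Fintype.card Γ : ℝ)⁻¹ • ∑ g, conjForm ρ g α with hβ
  have hβx : ∀ x, β x = (Fintype.card Γ : ℝ)⁻¹ • ∑ g, conjForm ρ g α x := fun x => by
    simp [hβ]
  refine ⟨β, fun x => ?_, fun x => ?_, fun h x => ?_, fun x y => ?_⟩
  · rw [hβx]
    exact Subalgebra.smul_mem _ (sum_mem fun g _ => mul_mem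
      (mul_mem (mulGrp_mem_rightLinear ρ g) (hαR _)) (mulGrp_mem_rightLinear ρ _)) _
  · rw [hβx, LinearMap.smul_apply, LinearMap.sum_apply, Finset.sum_eq_zero, smul_zero]
    intro g _
    rw [conjForm_apply, Module.End.mul_apply, Module.End.mul_apply, mulGrp_apply ρ g⁻¹, mul_one,
      hαg, map_zero]
  · rw [hβx, hβx, mul_smul_comm, smul_mul_assoc, Finset.mul_sum, Finset.sum_mul]
    congr 1
    refine Fintype.sum_equiv (Equiv.mulLeft h) _ _ fun g => ?_
    rw [conjForm_apply, conjForm_apply, Equiv.coe_mulLeft, mul_inv_rev, dual_mul_apply,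
      dual_inv_dual, mulGrp_mul, mulGrp_mul]
    simp only [mul_assoc, mulGrp_inv_mul, mul_one]
  · rw [← koszulD_apply]
    have hlin : koszulD ρ β x y = (Fintype.card Γ : ℝ)⁻¹ • ∑ g, koszulD ρ (conjForm ρ g α) x y := by
      simp only [koszulD_apply, commLin_apply, hβx, mul_smul_comm, smul_mul_assoc, Finset.mul_sum,
        Finset.sum_mul, Finset.sum_sub_distrib, smul_sub]
    have hg : ∀ g, koszulD ρ (conjForm ρ g α) x y = Ω x y := fun g => by
      rw [koszulD_conjForm, hα, hE, dual_dual_inv, dual_dual_inv, mul_assoc, mulGrp_mul_inv,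
        mul_one]
    rw [hlin, Finset.sum_congr rfl fun g _ => hg g, Finset.sum_const, Finset.card_univ,
      ← Nat.cast_smul_eq_nsmul ℝ, smul_smul, inv_mul_cancel₀, one_smul]
    exact Nat.cast_ne_zero.2 Fintype.card_ne_zero

end CrossedProduct
end
end CrossedPoisson

namespace CrossedPoisson

open scoped InnerProductSpace

noncomputable section

section CrossedProduct

variable {Γ : Type*} [Group Γ] {V : Type*} [AddCommGroup V] [Module ℝ V]
  (ρ : Representation ℝ Γ V)

/-! ### The universal property of the crossed product -/

theorem polyAlg_induction {motive : PolyAlg ρ → Prop}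
    (algebraMap : ∀ r, motive (algebraMap ℝ (PolyAlg ρ) r)) (ι : ∀ x, motive (polyι ρ x))
    (mul : ∀ a b, motive a → motive b → motive (a * b))
    (add : ∀ a b, motive a → motive b → motive (a + b)) (a : PolyAlg ρ) : motive a :=
  SymmetricAlgebra.induction (R := ℝ) (M := Module.Dual ℝ V) (motive := motive) algebraMap ι mul
    add a

theorem exists_polyAlg_lift {Q : Type*} [Ring Q] [Algebra ℝ Q] (l : Module.Dual ℝ V →ₗ[ℝ] Q)
    (hl : ∀ x y, l x * l y = l y * l x) :
    ∃ F : PolyAlg ρ →ₐ[ℝ] Q, ∀ x, F (polyι ρ x) = l x := by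
  have hcomm : ∀ a ∈ Set.range l, ∀ b ∈ Set.range l, a * b = b * a := by
    rintro _ ⟨x, rfl⟩ _ ⟨y, rfl⟩
    exact hl x y
  -- The target `Q` need not be commutative, so the lift is made into the commutative subalgebra
  -- generated by the values of `l`.
  have hc := Algebra.isMulCommutative_adjoin ℝ hcomm
  let : CommRing (Algebra.adjoin ℝ (Set.range l)) :=
    { Subalgebra.toRing (Algebra.adjoin ℝ (Set.range l)) with mul_comm := hc.is_comm.comm }
  let l' : Module.Dual ℝ V →ₗ[ℝ] Algebra.adjoin ℝ (Set.range l) :=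
    { toFun x := ⟨l x, Algebra.subset_adjoin ⟨x, rfl⟩⟩
      map_add' x y := Subtype.ext (map_add l x y)
      map_smul' r x := Subtype.ext (map_smul l r x) }
  refine ⟨(Algebra.adjoin ℝ (Set.range l)).val.comp (SymmetricAlgebra.lift l'), fun x => ?_⟩
  exact congrArg (Algebra.adjoin ℝ (Set.range l)).val (SymmetricAlgebra.lift_ι_apply l' x)

theorem exists_crossed_lift {Q : Type*} [Ring Q] [Algebra ℝ Q] (l : Module.Dual ℝ V →ₗ[ℝ] Q)
    (hl : ∀ x y, l x * l y = l y * l x) (U : Γ →* Q)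
    (hU : ∀ g x, U g * l x = l (ρ.dual g x) * U g) :
    ∃ F : Crossed ρ →ₐ[ℝ] Q, (∀ x, F (lin ρ x) = l x) ∧ ∀ g, F (grp ρ g) = U g := by
  obtain ⟨F, hF⟩ := exists_polyAlg_lift ρ l hl
  have h : ∀ (g : Γ) (a : PolyAlg ρ), F (g • a) * U g = U g * F a := by
    intro g a
    induction a using polyAlg_induction with
    | algebraMap r =>
      rw [smul_def, AlgHom.commutes, AlgHom.commutes]
      exact Algebra.commutes r (U g)
    | ι x => rw [smul_def, polyAct_ι, hF, hF, hU]
    | mul a b ha hb => rw [smul_mul', map_mul, map_mul, mul_assoc, hb, ← mul_assoc, ha, mul_assoc]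
    | add a b ha hb => rw [smul_add, map_add, map_add, add_mul, mul_add, ha, hb]
  refine ⟨SkewMonoidAlgebra.liftNCAlgHom F U (h _ _), fun x => ?_, fun g => ?_⟩
  · refine (SkewMonoidAlgebra.liftNC_single _ _ _ _).trans ?_
    change F (polyι ρ x) * U 1 = l x
    rw [map_one, mul_one, hF]
  · refine (SkewMonoidAlgebra.liftNC_single _ _ _ _).trans ?_
    change F 1 * U g = U g
    rw [map_one, one_mul]

theorem adjoin_lin_grp :
    Algebra.adjoin ℝ (Set.range (lin ρ) ∪ Set.range (grp ρ)) = ⊤ := by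
  refine eq_top_iff.2 fun a _ => ?_
  set S := Algebra.adjoin ℝ (Set.range (lin ρ) ∪ Set.range (grp ρ))
  have h1 : ∀ p : PolyAlg ρ, (SkewMonoidAlgebra.single 1 p : Crossed ρ) ∈ S := by
    intro p
    induction p using polyAlg_induction with
    | algebraMap r => exact S.algebraMap_mem r
    | ι x => exact Algebra.subset_adjoin (Or.inl ⟨x, rfl⟩)
    | mul p q hp hq =>
      have := S.mul_mem hp hq
      rwa [SkewMonoidAlgebra.single_mul_single, one_mul, one_smul] at this
    | add p q hp hq => rw [SkewMonoidAlgebra.single_add]; exact S.add_mem hp hq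
  have h2 : ∀ g (p : PolyAlg ρ), (SkewMonoidAlgebra.single g p : Crossed ρ) ∈ S := by
    intro g p
    have := S.mul_mem (h1 p) (Algebra.subset_adjoin (Or.inr ⟨g, rfl⟩) : grp ρ g ∈ S)
    rwa [grp, SkewMonoidAlgebra.single_mul_single, one_mul, one_smul, mul_one] at this
  rw [← SkewMonoidAlgebra.sum_single a, SkewMonoidAlgebra.sum_def]
  exact sum_mem fun g _ => h2 _ _

/-! ### Truncated formal power series of operators -/

/-- The linear operators on `A[t] / t³`. -/
abbrev JetEnd (A : Type*) [AddCommGroup A] [Module ℝ A] : Type _ := Module.End ℝ (A × A × A)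

/-- The operator `p + q t + r t²` on `A[t] / t³`. -/
def trunc {A : Type*} [AddCommGroup A] [Module ℝ A] (p q r : Module.End ℝ A) :
    JetEnd A where
  toFun m := (p m.1, p m.2.1 + q m.1, p m.2.2 + q m.2.1 + r m.1)
  map_add' m n := by
    refine Prod.ext (by simp) (Prod.ext ?_ ?_) <;> simp <;> abel
  map_smul' c m := by
    refine Prod.ext (by simp) (Prod.ext ?_ ?_) <;> simp

section Trunc

variable {A : Type*} [AddCommGroup A] [Module ℝ A]

theorem trunc_apply (p q r : Module.End ℝ A) (m : A × A × A) :
    trunc p q r m = (p m.1, p m.2.1 + q m.1, p m.2.2 + q m.2.1 + r m.1) := rfl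

theorem trunc_mul (p q r p' q' r' : Module.End ℝ A) :
    trunc p q r * trunc p' q' r' = trunc (p * p') (p * q' + q * p') (p * r' + q * q' + r * p') := by
  refine LinearMap.ext fun m => Prod.ext ?_ (Prod.ext ?_ ?_) <;>
    simp [trunc_apply] <;> abel

theorem trunc_add (p q r p' q' r' : Module.End ℝ A) :
    trunc p q r + trunc p' q' r' = trunc (p + p') (q + q') (r + r') := by
  refine LinearMap.ext fun m => Prod.ext ?_ (Prod.ext ?_ ?_) <;>
    simp [trunc_apply] <;> abel

theorem trunc_sub (p q r p' q' r' : Module.End ℝ A) :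
    trunc p q r - trunc p' q' r' = trunc (p - p') (q - q') (r - r') := by
  refine LinearMap.ext fun m => Prod.ext ?_ (Prod.ext ?_ ?_) <;>
    simp [trunc_apply] <;> abel

theorem trunc_smul (c : ℝ) (p q r : Module.End ℝ A) :
    c • trunc p q r = trunc (c • p) (c • q) (c • r) := by
  refine LinearMap.ext fun m => Prod.ext ?_ (Prod.ext ?_ ?_) <;>
    simp [trunc_apply]

theorem trunc_one : (trunc 1 0 0 : JetEnd A) = 1 := by
  refine LinearMap.ext fun m => Prod.ext ?_ (Prod.ext ?_ ?_) <;> simp [trunc_apply]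

theorem trunc_zero : (trunc 0 0 0 : JetEnd A) = 0 := by
  refine LinearMap.ext fun m => Prod.ext ?_ (Prod.ext ?_ ?_) <;> simp [trunc_apply]

theorem sum_trunc {κ : Type*} (s : Finset κ) (p q r : κ → Module.End ℝ A) :
    ∑ i ∈ s, trunc (p i) (q i) (r i) = trunc (∑ i ∈ s, p i) (∑ i ∈ s, q i) (∑ i ∈ s, r i) := by
  classical
  induction s using Finset.induction_on with
  | empty => simp [trunc_zero]
  | insert i s hi ih => simp only [Finset.sum_insert hi, ih, trunc_add]

/-- Multiplication by `t` on `A[t] / t³`. -/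
def truncT : JetEnd A := trunc 0 1 0

theorem truncT_apply (m : A × A × A) : (truncT : JetEnd A) m = (0, m.1, m.2.1) := by
  simp [truncT, trunc_apply]

theorem truncT_mul (p q r : Module.End ℝ A) : truncT * trunc p q r = trunc 0 p q := by
  simp [truncT, trunc_mul]

theorem trunc_mul_truncT (p q r : Module.End ℝ A) : trunc p q r * truncT = trunc 0 p q := by
  simp [truncT, trunc_mul]

end Trunc

/-! ### Flatness of the deformation defined by operators -/

/-- The algebra generated by `t`, the deformed linear forms and the group. -/
def opAlg (L : Module.Dual ℝ V →ₗ[ℝ] JetEnd (Crossed ρ)) :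
    Subalgebra ℝ (JetEnd (Crossed ρ)) :=
  Algebra.adjoin ℝ (insert truncT (Set.range L ∪ Set.range fun g => trunc (mulGrp ρ g) 0 0))

variable (L : Module.Dual ℝ V →ₗ[ℝ] JetEnd (Crossed ρ))

theorem truncT_mem : truncT ∈ opAlg ρ L := Algebra.subset_adjoin (Or.inl rfl)

theorem deformedLin_mem (x : Module.Dual ℝ V) : L x ∈ opAlg ρ L :=
  Algebra.subset_adjoin (Or.inr (Or.inl ⟨x, rfl⟩))

theorem trunc_mulGrp_mem (g : Γ) : trunc (mulGrp ρ g) 0 0 ∈ opAlg ρ L :=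
  Algebra.subset_adjoin (Or.inr (Or.inr ⟨g, rfl⟩))

theorem commute_truncT_of_mem (hLT : ∀ x, L x * truncT = truncT * L x) {h} (hh : h ∈ opAlg ρ L) :
    h * truncT = truncT * h := by
  have : opAlg ρ L ≤ Subalgebra.centralizer ℝ {truncT} := by
    refine Algebra.adjoin_le ?_
    rintro _ (rfl | ⟨x, rfl⟩ | ⟨g, rfl⟩)
    · exact Subalgebra.mem_centralizer_iff ℝ |>.2 fun y hy => by rw [Set.mem_singleton_iff.1 hy]
    · exact Subalgebra.mem_centralizer_iff ℝ |>.2 fun y hy => by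
        rw [Set.mem_singleton_iff.1 hy, hLT]
    · exact Subalgebra.mem_centralizer_iff ℝ |>.2 fun y hy => by
        rw [Set.mem_singleton_iff.1 hy, trunc_mul_truncT, truncT_mul]
  exact ((Subalgebra.mem_centralizer_iff ℝ).1 (this hh) _ rfl).symm

/-- Passes from generators to the whole algebra; it makes the deformed product right linear over the
group and compatible with `S (a g) = S a γ`. -/
theorem commute_mulRight_of_mem (g : Γ)
    (hLR : ∀ x, L x * trunc (LinearMap.mulRight ℝ (grp ρ g)) 0 0 =
      trunc (LinearMap.mulRight ℝ (grp ρ g)) 0 0 * L x) {h} (hh : h ∈ opAlg ρ L) :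
    h * trunc (LinearMap.mulRight ℝ (grp ρ g)) 0 0 =
      trunc (LinearMap.mulRight ℝ (grp ρ g)) 0 0 * h := by
  have : opAlg ρ L ≤ Subalgebra.centralizer ℝ {trunc (LinearMap.mulRight ℝ (grp ρ g)) 0 0} := by
    refine Algebra.adjoin_le ?_
    rintro _ (rfl | ⟨x, rfl⟩ | ⟨k, rfl⟩)
    · exact Subalgebra.mem_centralizer_iff ℝ |>.2 fun y hy => by
        rw [Set.mem_singleton_iff.1 hy, trunc_mul_truncT, truncT_mul]
    · exact Subalgebra.mem_centralizer_iff ℝ |>.2 fun y hy => by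
        rw [Set.mem_singleton_iff.1 hy, hLR]
    · refine Subalgebra.mem_centralizer_iff ℝ |>.2 fun y hy => ?_
      have : LinearMap.mulRight ℝ (grp ρ g) * mulGrp ρ k =
          mulGrp ρ k * LinearMap.mulRight ℝ (grp ρ g) :=
        LinearMap.ext fun a => by simp [mulGrp_apply, mul_assoc]
      rw [Set.mem_singleton_iff.1 hy, trunc_mul, trunc_mul, this]
      simp
  exact ((Subalgebra.mem_centralizer_iff ℝ).1 (this hh) _ rfl).symm

/-- Every generator acts on constant terms by a left multiplication, and these are closed under sums
and products. The symbol, read off at `1`, is thus multiplicative. -/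
theorem exists_symbol (hL : ∀ x m, (L x m).1 = lin ρ x * m.1) {h} (hh : h ∈ opAlg ρ L) :
    ∃ a, ∀ m, (h m).1 = a * m.1 := by
  induction hh using Algebra.adjoin_induction with
  | mem h hh =>
    rcases hh with rfl | ⟨x, rfl⟩ | ⟨g, rfl⟩
    · exact ⟨0, fun m => by simp [truncT_apply]⟩
    · exact ⟨_, hL x⟩
    · exact ⟨grp ρ g, fun m => rfl⟩
  | algebraMap r => exact ⟨algebraMap ℝ _ r, fun m => by
      rw [Module.algebraMap_end_apply, Prod.smul_fst, Algebra.smul_def]⟩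
  | add h k _ _ ha hb =>
    obtain ⟨⟨a, ha⟩, b, hb⟩ := And.intro ha hb
    exact ⟨a + b, fun m => by rw [LinearMap.add_apply, Prod.fst_add, ha, hb, add_mul]⟩
  | mul h k _ _ ha hb =>
    obtain ⟨⟨a, ha⟩, b, hb⟩ := And.intro ha hb
    exact ⟨a * b, fun m => by rw [Module.End.mul_apply, ha, hb, mul_assoc]⟩

theorem symbol_apply (hL : ∀ x m, (L x m).1 = lin ρ x * m.1) {h} (hh : h ∈ opAlg ρ L)
    (m : Crossed ρ × Crossed ρ × Crossed ρ) : (h m).1 = (h (1, 0, 0)).1 * m.1 := by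
  obtain ⟨a, ha⟩ := exists_symbol ρ L hL hh
  rw [ha, ha, mul_one]

theorem exists_mem_symbol_eq (hL : ∀ x m, (L x m).1 = lin ρ x * m.1) (a : Crossed ρ) :
    ∃ h ∈ opAlg ρ L, (h (1, 0, 0)).1 = a := by
  have ha : a ∈ Algebra.adjoin ℝ (Set.range (lin ρ) ∪ Set.range (grp ρ)) := by
    rw [adjoin_lin_grp]; trivial
  induction ha using Algebra.adjoin_induction with
  | mem a ha =>
    rcases ha with ⟨x, rfl⟩ | ⟨g, rfl⟩
    · exact ⟨L x, deformedLin_mem ρ L x, by rw [hL, mul_one]⟩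
    · exact ⟨_, trunc_mulGrp_mem ρ L g, mul_one _⟩
  | algebraMap r => exact ⟨algebraMap ℝ _ r, Subalgebra.algebraMap_mem _ r, by
      rw [Module.algebraMap_end_apply, Prod.smul_fst, Algebra.algebraMap_eq_smul_one]⟩
  | add a b _ _ ha hb =>
    obtain ⟨⟨h, hh, ha⟩, k, hk, hb⟩ := And.intro ha hb
    exact ⟨h + k, add_mem hh hk, by rw [LinearMap.add_apply, Prod.fst_add, ha, hb]⟩
  | mul a b _ _ ha hb =>
    obtain ⟨⟨h, hh, ha⟩, k, hk, hb⟩ := And.intro ha hb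
    exact ⟨h * k, mul_mem hh hk, by
      rw [Module.End.mul_apply, symbol_apply ρ L hL hh, ha, hb]⟩

/-- An element of an algebra generated by a central element `T`, by images of the linear forms that
commute modulo `T`, and by the group, is divisible by `T` if its symbol vanishes. -/
theorem exists_eq_mul_of_symbol_eq_zero {E : Type*} [Ring E] [Algebra ℝ E] (T : E)
    (L : Module.Dual ℝ V →ₗ[ℝ] E) (U : Γ →* E) (S : Subalgebra ℝ E)
    (hS : S = Algebra.adjoin ℝ (insert T (Set.range L ∪ Set.range U)))
    (hT : ∀ k ∈ S, k * T = T * k) (hLU : ∀ g x, U g * L x = L (ρ.dual g x) * U g)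
    (hLL : ∀ x y, ∃ h ∈ S, L x * L y - L y * L x = T * h) (σ : E →ₗ[ℝ] Crossed ρ)
    (hσ1 : σ 1 = 1) (hσm : ∀ h ∈ S, ∀ k ∈ S, σ (h * k) = σ h * σ k) (hσT : σ T = 0)
    (hσL : ∀ x, σ (L x) = lin ρ x) (hσU : ∀ g, σ (U g) = grp ρ g) {h : E} (hh : h ∈ S)
    (h0 : σ h = 0) : ∃ k ∈ S, h = T * k := by
  subst hS
  set S := Algebra.adjoin ℝ (insert T (Set.range L ∪ Set.range U)) with hS
  let T' : S := ⟨T, Algebra.subset_adjoin (Or.inl rfl)⟩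
  have hT' : ∀ k : S, k * T' = T' * k := fun k => Subtype.ext (hT k.1 k.2)
  let I : Ideal S := Ideal.span {T'}
  have hI : ∀ k, k ∈ I ↔ ∃ l, l * T' = k := fun k => Ideal.mem_span_singleton'
  have : I.IsTwoSided := ⟨fun {a} b ha => by
    obtain ⟨l, rfl⟩ := (hI a).1 ha
    exact (hI _).2 ⟨l * b, by rw [mul_assoc, mul_assoc, hT']⟩⟩
  let q : S →ₐ[ℝ] (S ⧸ I) := Ideal.Quotient.mkₐ ℝ I
  have hq : ∀ k, q k = 0 ↔ k ∈ I := fun k => Ideal.Quotient.eq_zero_iff_mem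
  let L' : Module.Dual ℝ V →ₗ[ℝ] S := L.codRestrict (Subalgebra.toSubmodule S)
    fun x => Algebra.subset_adjoin (Or.inr (Or.inl ⟨x, rfl⟩))
  let U' : Γ →* S := U.codRestrict S fun g => Algebra.subset_adjoin (Or.inr (Or.inr ⟨g, rfl⟩))
  -- Modulo `T` the generators satisfy the relations of the crossed product, so the quotient map
  -- factors through the symbol; elements of zero symbol die in the quotient, that is, they lie in
  -- `T S`.
  obtain ⟨F, hF1, hF2⟩ := exists_crossed_lift ρ (q.toLinearMap ∘ₗ L')
    (fun x y => by
      obtain ⟨k, hk, e⟩ := hLL x y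
      have : q (L' x * L' y - L' y * L' x) = 0 :=
        (hq _).2 ((hI _).2 ⟨⟨k, hk⟩, by rw [hT']; exact Subtype.ext e.symm⟩)
      rw [map_sub, map_mul, map_mul] at this
      exact sub_eq_zero.1 this)
    ((q : S →* (S ⧸ I)).comp U')
    (fun g x => by
      have : U' g * L' x = L' (ρ.dual g x) * U' g := Subtype.ext (hLU g x)
      have := congrArg q this
      rwa [map_mul, map_mul] at this)
  let s : S →ₐ[ℝ] Crossed ρ := AlgHom.ofLinearMap (σ ∘ₗ S.val.toLinearMap) hσ1
    (fun k l => hσm _ k.2 _ l.2)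
  have hFs : F.comp s = q := by
    refine AlgHom.adjoin_ext fun k hk => ?_
    rcases hk with rfl | ⟨x, rfl⟩ | ⟨g, rfl⟩
    · have h2 : q T' = 0 := (hq _).2 ((hI _).2 ⟨1, one_mul _⟩)
      change F (s T') = q T'
      rw [show s T' = 0 from hσT, h2, map_zero]
    · change F (s (L' x)) = q (L' x)
      rw [show s (L' x) = lin ρ x from hσL x, hF1]; rfl
    · change F (s (U' g)) = q (U' g)
      rw [show s (U' g) = grp ρ g from hσU g, hF2]; rfl
  have hz : q ⟨h, hh⟩ = 0 := by
    rw [← hFs]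
    change F (s ⟨h, hh⟩) = 0
    rw [show s ⟨h, hh⟩ = 0 from h0, map_zero]
  obtain ⟨k, hk⟩ := (hI _).1 ((hq _).1 hz)
  exact ⟨k.1, k.2, by rw [← hT _ k.2]; exact (congrArg Subtype.val hk).symm⟩

/-- An operator without constant term is divisible by `t`. -/
theorem exists_eq_truncT_mul (hL : ∀ x m, (L x m).1 = lin ρ x * m.1)
    (hLT : ∀ x, L x * truncT = truncT * L x)
    (hLU : ∀ g x, trunc (mulGrp ρ g) 0 0 * L x = L (ρ.dual g x) * trunc (mulGrp ρ g) 0 0)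
    (hLL : ∀ x y, ∃ h ∈ opAlg ρ L, L x * L y - L y * L x = truncT * h)
    {h} (hh : h ∈ opAlg ρ L) (h0 : (h (1, 0, 0)).1 = 0) :
    ∃ k ∈ opAlg ρ L, h = truncT * k := by
  let U : Γ →* JetEnd (Crossed ρ) :=
    { toFun g := trunc (mulGrp ρ g) 0 0
      map_one' := by rw [mulGrp_one, trunc_one]
      map_mul' g k := by rw [trunc_mul, mulGrp_mul]; simp }
  let σ : JetEnd (Crossed ρ) →ₗ[ℝ] Crossed ρ :=
    { toFun k := (k (1, 0, 0)).1
      map_add' k l := rfl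
      map_smul' r k := rfl }
  exact exists_eq_mul_of_symbol_eq_zero ρ truncT L U (opAlg ρ L) rfl
    (fun k hk => commute_truncT_of_mem ρ L hLT hk) hLU hLL σ rfl
    (fun h hh k hk => symbol_apply ρ L hL hh _) (congrArg Prod.fst (truncT_apply _))
    (fun x => (hL x _).trans (mul_one _)) (fun g => mul_one _) hh h0

/-- Flatness of the deformation. An operator that kills `1` has zero symbol, so it is divisible by
`t`; repeating this three times gives zero because `t³ = 0`. Surjectivity corrects one coefficient
at a time. -/
theorem exists_opAlg_equiv (hL : ∀ x m, (L x m).1 = lin ρ x * m.1)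
    (hLT : ∀ x, L x * truncT = truncT * L x)
    (hLU : ∀ g x, trunc (mulGrp ρ g) 0 0 * L x = L (ρ.dual g x) * trunc (mulGrp ρ g) 0 0)
    (hLL : ∀ x y, ∃ h ∈ opAlg ρ L, L x * L y - L y * L x = truncT * h) :
    ∃ e : opAlg ρ L ≃ₗ[ℝ] Crossed ρ × Crossed ρ × Crossed ρ, ∀ h, e h = h.1 (1, 0, 0) := by
  let ev : opAlg ρ L →ₗ[ℝ] Crossed ρ × Crossed ρ × Crossed ρ :=
    { toFun k := k.1 (1, 0, 0)
      map_add' k l := rfl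
      map_smul' r k := rfl }
  have hdiv := fun {h} => exists_eq_truncT_mul ρ L hL hLT hLU hLL (h := h)
  have htt : (truncT * (truncT * truncT) : JetEnd (Crossed ρ)) = 0 :=
    LinearMap.ext fun m => by simp [truncT_apply]
  refine ⟨LinearEquiv.ofBijective ev ⟨?_, fun m => ?_⟩, fun h => rfl⟩
  · rintro ⟨h₁, hh₁⟩ ⟨h₂, hh₂⟩ he
    refine Subtype.ext (sub_eq_zero.1 ?_)
    change h₁ (1, 0, 0) = h₂ (1, 0, 0) at he
    have h0 : (h₁ - h₂) (1, 0, 0) = 0 := by rw [LinearMap.sub_apply, he, sub_self]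
    obtain ⟨k, hk, e⟩ := hdiv ((opAlg ρ L).sub_mem hh₁ hh₂) (by rw [h0]; rfl)
    change h₁ - h₂ = 0
    rw [e] at h0 ⊢
    rw [Module.End.mul_apply, truncT_apply, Prod.ext_iff, Prod.ext_iff] at h0
    obtain ⟨l, hl, rfl⟩ := hdiv hk h0.2.1
    have h1 := h0.2.2
    rw [Module.End.mul_apply, truncT_apply] at h1
    obtain ⟨n, hn, rfl⟩ := hdiv hl h1
    rw [← mul_assoc, ← mul_assoc, mul_assoc truncT, htt, zero_mul]
  · obtain ⟨h, hh, h0⟩ := exists_mem_symbol_eq ρ L hL m.1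
    obtain ⟨k, hk, k0⟩ := exists_mem_symbol_eq ρ L hL (m.2.1 - (h (1, 0, 0)).2.1)
    -- The `t²` coefficient already receives contributions from `h` and from `t k`, which are
    -- subtracted.
    obtain ⟨l, hl, l0⟩ := exists_mem_symbol_eq ρ L hL
      (m.2.2 - (h (1, 0, 0)).2.2 - (k (1, 0, 0)).2.1)
    have hT := truncT_mem ρ L
    refine ⟨⟨h + truncT * k + truncT * (truncT * l),
      add_mem (add_mem hh (mul_mem hT hk)) (mul_mem hT (mul_mem hT hl))⟩, ?_⟩
    change (h + truncT * k + truncT * (truncT * l) : JetEnd (Crossed ρ)) (1, 0, 0) = m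
    simp only [LinearMap.add_apply, Module.End.mul_apply, truncT_apply]
    refine Prod.ext ?_ (Prod.ext ?_ ?_)
    · simp [h0]
    · simp [k0]
    · simp [l0]

end CrossedProduct
end
end CrossedPoisson

namespace CrossedPoisson

open scoped InnerProductSpace

noncomputable section

section CrossedProduct

variable {Γ : Type*} [Group Γ] {V : Type*} [AddCommGroup V] [Module ℝ V]
  (ρ : Representation ℝ Γ V)

/-! ### The deformed product -/

/-- The equations for `α` and `β` are the coefficients of `t` and `t²` in `[L x, L y] = t ∑ L(P γ x
y) γ - t² ∑ κ γ x y γ`. Flatness then turns the composition of operators into a product on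
`A[t]/t³`. -/
theorem exists_twoCochains_of_operators [Fintype Γ] (P : Γ → LinBivector V)
    (κ : Γ → Module.Dual ℝ V → Module.Dual ℝ V → ℝ)
    (α β : Module.Dual ℝ V →ₗ[ℝ] Module.End ℝ (Crossed ρ))
    (hαR : ∀ x, α x ∈ rightLinear ρ) (hβR : ∀ x, β x ∈ rightLinear ρ)
    (hα1 : ∀ x, α x 1 = 0) (hβ1 : ∀ x, β x 1 = 0)
    (hαE : ∀ g x, mulGrp ρ g * α x = α (ρ.dual g x) * mulGrp ρ g)
    (hβE : ∀ g x, mulGrp ρ g * β x = β (ρ.dual g x) * mulGrp ρ g)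
    (hα : ∀ x y, commLin ρ x (α y) - commLin ρ y (α x) =
      ∑ γ, mulLin ρ (P γ x y) * mulGrp ρ γ)
    (hβ : ∀ x y, commLin ρ x (β y) - commLin ρ y (β x) =
      ∑ γ, α (P γ x y) * mulGrp ρ γ - (α x * α y - α y * α x) - ∑ γ, κ γ x y • mulGrp ρ γ) :
    ∃ f h : TwoCochain (Crossed ρ), IsTwoCocycle f ∧
      (∀ g a b, f (grp ρ g * a) b = grp ρ g * f a b) ∧
      (∀ g a b, f (a * grp ρ g) b = f a (grp ρ g * b)) ∧
      (∀ g a b, f a (b * grp ρ g) = f a b * grp ρ g) ∧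
      (∀ x y, f (lin ρ x) (lin ρ y) - f (lin ρ y) (lin ρ x) =
        ∑ γ, lin ρ (P γ x y) * grp ρ γ) ∧
      ∀ a b c, circ f f a b c = hochschildD h a b c := by
  let L : Module.Dual ℝ V →ₗ[ℝ] JetEnd (Crossed ρ) :=
    { toFun x := trunc (mulLin ρ x) (α x) (β x)
      map_add' x y := by rw [trunc_add, map_add, map_add, map_add]
      map_smul' r x := by rw [RingHom.id_apply, trunc_smul, map_smul, map_smul, map_smul] }
  have hLx : ∀ x, L x = trunc (mulLin ρ x) (α x) (β x) := fun x => rfl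
  have hL : ∀ x m, (L x m).1 = lin ρ x * m.1 := fun x m => rfl
  have hLT : ∀ x, L x * truncT = truncT * L x := fun x => by
    rw [hLx, trunc_mul_truncT, truncT_mul]
  have hLU : ∀ g x, trunc (mulGrp ρ g) 0 0 * L x = L (ρ.dual g x) * trunc (mulGrp ρ g) 0 0 :=
    fun g x => by
      rw [hLx, hLx, trunc_mul, trunc_mul, mulGrp_mul_mulLin, hαE, hβE]
      simp only [zero_mul, mul_zero, add_zero, zero_add]
  have hR : ∀ (φ : Module.End ℝ (Crossed ρ)) g, φ ∈ rightLinear ρ →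
      φ * LinearMap.mulRight ℝ (grp ρ g) = LinearMap.mulRight ℝ (grp ρ g) * φ :=
    fun φ g hφ => LinearMap.ext fun a => (mem_rightLinear ρ).1 hφ a g
  have hLR : ∀ g x, L x * trunc (LinearMap.mulRight ℝ (grp ρ g)) 0 0 =
      trunc (LinearMap.mulRight ℝ (grp ρ g)) 0 0 * L x := fun g x => by
    rw [hLx, trunc_mul, trunc_mul, hR _ g (hαR x), hR _ g (hβR x),
      hR _ g (mulLin_mem_rightLinear ρ x)]
    simp only [mul_zero, zero_mul, add_zero, zero_add]
  have hLL : ∀ x y, ∃ h ∈ opAlg ρ L, L x * L y - L y * L x = truncT * h := fun x y => by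
    refine ⟨∑ γ, L (P γ x y) * trunc (mulGrp ρ γ) 0 0 -
      truncT * ∑ γ, κ γ x y • trunc (mulGrp ρ γ) 0 0, ?_, ?_⟩
    · exact (opAlg ρ L).sub_mem
        ((opAlg ρ L).sum_mem fun γ _ =>
          (opAlg ρ L).mul_mem (deformedLin_mem ρ L _) (trunc_mulGrp_mem ρ L γ))
        ((opAlg ρ L).mul_mem (truncT_mem ρ L) ((opAlg ρ L).sum_mem fun γ _ =>
          (opAlg ρ L).smul_mem (trunc_mulGrp_mem ρ L γ) _))
    · have h1 := hα x y
      have h2 := hβ x y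
      simp only [commLin_apply] at h1 h2
      simp only [hLx, trunc_mul, trunc_smul, sum_trunc, truncT_mul, trunc_sub, mul_zero, add_zero,
        smul_zero, Finset.sum_const_zero, zero_add]
      rw [mulLin_comm ρ x y, sub_self, sub_zero, ← h1]
      congr 1
      · abel
      · have h3 : ∑ γ, α (P γ x y) * mulGrp ρ γ - ∑ γ, κ γ x y • mulGrp ρ γ =
            (mulLin ρ x * β y - β y * mulLin ρ x - (mulLin ρ y * β x - β x * mulLin ρ y)) +
            (α x * α y - α y * α x) := by rw [h2]; abel
        rw [h3]
        abel
  obtain ⟨e, he⟩ := exists_opAlg_equiv ρ L hL hLT hLU hLL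
  have huniq : ∀ h ∈ opAlg ρ L, ∀ k ∈ opAlg ρ L, h (1, 0, 0) = k (1, 0, 0) → h = k :=
    fun h hh k hk hhk => congrArg Subtype.val (e.injective (a₁ := ⟨h, hh⟩) (a₂ := ⟨k, hk⟩)
      (by rw [he, he]; exact hhk))
  -- `S a` is the unique operator of the algebra whose value at `1` is the constant `a`; it is left
  -- multiplication by `a` in the deformed product.
  let S : Crossed ρ →ₗ[ℝ] JetEnd (Crossed ρ) :=
    (opAlg ρ L).val.toLinearMap ∘ₗ e.symm.toLinearMap ∘ₗ LinearMap.inl ℝ _ _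
  have hSm : ∀ a, S a ∈ opAlg ρ L := fun a => (e.symm (a, 0, 0)).2
  have hS1 : ∀ a, S a (1, 0, 0) = (a, 0, 0) := fun a =>
    (he (e.symm (a, 0, 0))).symm.trans (e.apply_symm_apply _)
  have hadd : ∀ a b b', S a (b + b', 0, 0) = S a (b, 0, 0) + S a (b', 0, 0) := fun a b b' => by
    rw [← map_add]; simp
  have hsmul : ∀ (r : ℝ) a b, S a (r • b, 0, 0) = r • S a (b, 0, 0) := fun r a b => by
    rw [← map_smul]; simp
  let f : TwoCochain (Crossed ρ) := LinearMap.mk₂ ℝ (fun a b => (S a (b, 0, 0)).2.1)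
    (fun a a' b => by simp) (fun r a b => by simp) (fun a b b' => by rw [hadd]; rfl)
    (fun r a b => by rw [hsmul]; rfl)
  let h : TwoCochain (Crossed ρ) := LinearMap.mk₂ ℝ (fun a b => (S a (b, 0, 0)).2.2)
    (fun a a' b => by simp) (fun r a b => by simp) (fun a b b' => by rw [hadd]; rfl)
    (fun r a b => by rw [hsmul]; rfl)
  have hf : ∀ a b, (S a (b, 0, 0)).2.1 = f a b := fun a b => rfl
  have hS0 : ∀ a b, S a (b, 0, 0) = (a * b, f a b, h a b) := fun a b => by
    refine Prod.ext ?_ rfl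
    rw [symbol_apply ρ L hL (hSm a), hS1]
  have hSt : ∀ a, S a = trunc (LinearMap.mulLeft ℝ a) (f a) (h a) := fun a => by
    refine LinearMap.ext fun m => ?_
    have hT : ∀ n, S a (truncT n) = truncT (S a n) := fun n =>
      LinearMap.congr_fun (commute_truncT_of_mem ρ L hLT (hSm a)) n
    have hm : m = (m.1, 0, 0) + truncT (m.2.1, 0, 0) + truncT (truncT (m.2.2, 0, 0)) := by
      simp only [truncT_apply]
      refine Prod.ext ?_ (Prod.ext ?_ ?_) <;> simp
    conv_lhs => rw [hm]
    rw [map_add, map_add, hT, hT, hT, hS0, hS0, hS0]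
    simp only [truncT_apply, trunc_apply]
    refine Prod.ext ?_ (Prod.ext ?_ ?_) <;> simp <;> abel
  -- Both sides lie in the algebra and agree at `1`. Applying them to `c` gives the associativity
  -- relations at orders `t` and `t²`.
  have hassoc : ∀ a b, S a * S b = S (a * b) + truncT * S (f a b) + truncT * (truncT * S (h a b)) :=
    fun a b => by
      have hT := truncT_mem ρ L
      refine huniq _ ((opAlg ρ L).mul_mem (hSm a) (hSm b)) _ ((opAlg ρ L).add_mem
        ((opAlg ρ L).add_mem (hSm _) ((opAlg ρ L).mul_mem hT (hSm _)))
        ((opAlg ρ L).mul_mem hT ((opAlg ρ L).mul_mem hT (hSm _)))) ?_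
      simp only [LinearMap.add_apply, Module.End.mul_apply, hS1, hS0, truncT_apply]
      refine Prod.ext ?_ (Prod.ext ?_ ?_) <;> simp
  have hcomp : ∀ a b c, a * f b c + f a (b * c) = f (a * b) c + f a b * c ∧
      a * h b c + f a (f b c) + h a (b * c) = h (a * b) c + f (f a b) c + h a b * c := by
    intro a b c
    have := LinearMap.congr_fun (hassoc a b) (c, 0, 0)
    simp only [LinearMap.add_apply, Module.End.mul_apply, hS0, truncT_apply] at this
    rw [hSt] at this
    simp only [trunc_apply, Prod.mk_add_mk, Prod.mk.injEq, LinearMap.mulLeft_apply, add_zero] at this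
    exact this.2
  have hleft : ∀ g a, S (grp ρ g * a) = trunc (mulGrp ρ g) 0 0 * S a := fun g a =>
    huniq _ (hSm _) _ ((opAlg ρ L).mul_mem (trunc_mulGrp_mem ρ L g) (hSm a)) (by
      rw [Module.End.mul_apply, hS1, hS1, trunc_apply]
      simp [mulGrp_apply])
  have hmid : ∀ g a, S (a * grp ρ g) = S a * trunc (mulGrp ρ g) 0 0 := fun g a =>
    huniq _ (hSm _) _ ((opAlg ρ L).mul_mem (hSm a) (trunc_mulGrp_mem ρ L g)) (by
      have h1 := LinearMap.congr_fun (commute_mulRight_of_mem ρ L g (hLR g) (hSm a)) (1, 0, 0)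
      rw [Module.End.mul_apply, Module.End.mul_apply, hS1] at h1
      rw [Module.End.mul_apply, hS1]
      simpa [trunc_apply, mulGrp_apply] using h1.symm)
  -- The normalisation of `α` and `β` at `1` enters here, and yields `f x b = α x b` below.
  have hlin : ∀ x, S (lin ρ x) = L x := fun x =>
    huniq _ (hSm _) _ (deformedLin_mem ρ L x) (by
      rw [hS1, hLx, trunc_apply]
      simp [mulLin_apply, hα1, hβ1])
  refine ⟨f, h, fun a b c => ?_, fun g a b => ?_, fun g a b => ?_, fun g a b => ?_, fun x y => ?_,
    fun a b c => ?_⟩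
  · rw [hochschildD, ← sub_eq_zero.2 (hcomp a b c).1]
    abel
  · rw [← hf, hleft, Module.End.mul_apply, hS0, trunc_apply]
    simp [mulGrp_apply]
  · rw [← hf, hmid, Module.End.mul_apply, trunc_apply]
    simp [mulGrp_apply, hS0]
  · have h1 := LinearMap.congr_fun (commute_mulRight_of_mem ρ L g (hLR g) (hSm a)) (b, 0, 0)
    rw [Module.End.mul_apply, Module.End.mul_apply, hS0, trunc_apply, trunc_apply] at h1
    simp only [LinearMap.mulRight_apply, map_zero, LinearMap.zero_apply, add_zero, hS0,
      Prod.mk.injEq] at h1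
    exact h1.2.1
  · have h1 : ∀ x b, f (lin ρ x) b = α x b := fun x b => by
      rw [← hf, hlin, hLx, trunc_apply]
      simp
    have h2 := LinearMap.congr_fun (hα x y) 1
    simp only [commLin_apply, LinearMap.sub_apply, Module.End.mul_apply, LinearMap.sum_apply,
      hα1, map_zero, mulLin_apply, mulGrp_apply, mul_one] at h2
    rw [h1, h1, ← h2]
    abel
  · have h1 := (hcomp a b c).2
    rw [circ, hochschildD, sub_eq_iff_eq_add, ← sub_eq_zero]
    rw [← sub_eq_zero] at h1
    rw [← neg_eq_zero, ← h1]
    abel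

end CrossedProduct
end
end CrossedPoisson

namespace CrossedPoisson

open scoped InnerProductSpace

noncomputable section

section CrossedProduct

open scoped TensorProduct

variable {Γ : Type*} [Group Γ] {V : Type*} [AddCommGroup V] [Module ℝ V]
  (ρ : Representation ℝ Γ V)

/-! ### Solving the deformation equations -/

theorem commLin_mul_mulGrp (x : Module.Dual ℝ V) (φ : Module.End ℝ (Crossed ρ)) (γ : Γ) :
    commLin ρ x (φ * mulGrp ρ γ) =
      (mulLin ρ x * φ - φ * mulLin ρ (ρ.dual γ x)) * mulGrp ρ γ := by
  rw [commLin_apply, sub_mul, mul_assoc φ, mulGrp_mul_mulLin, mul_assoc, mul_assoc]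

theorem neg_mul_mul_eq {E : Type*} [Ring E] (a b c : E) : -a * b * c = -(a * (b * c)) := by
  rw [neg_mul, neg_mul, mul_assoc]

theorem cyclic_sum_eq_zero {E : Type*} [AddCommGroup E] {a₁ a₂ a₃ b₁ b₂ b₃ s₁ s₂ s₃ k₁ k₂ k₃ : E}
    (h : a₁ + a₂ + a₃ - (b₁ + b₂ + b₃) = -s₁ + -s₂ + -s₃) (hk : s₁ + s₂ + s₃ = k₁ + k₂ + k₃) :
    (a₁ - b₁ - -k₁) + (a₂ - b₂ - -k₂) + (a₃ - b₃ - -k₃) = 0 := by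
  have e : (a₁ - b₁ - -k₁) + (a₂ - b₂ - -k₂) + (a₃ - b₃ - -k₃) =
      a₁ + a₂ + a₃ - (b₁ + b₂ + b₃) + (k₁ + k₂ + k₃) := by abel
  rw [e, h, ← hk]
  abel

/-- Graded Leibniz rule for the self-bracket of a one-form: the Koszul differential of `[α, α]` is
expressed by commutators of `α` with `dα`. -/
theorem commutator_jacobi {E : Type*} [Ring E] (a b c p q r : E) :
    (a * (q * r - r * q) - (q * r - r * q) * a) + (b * (r * p - p * r) - (r * p - p * r) * b) +
      (c * (p * q - q * p) - (p * q - q * p) * c) =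
    -((p * (b * r - r * b - (c * q - q * c)) - (b * r - r * b - (c * q - q * c)) * p) +
      (q * (c * p - p * c - (a * r - r * a)) - (c * p - p * c - (a * r - r * a)) * q) +
      (r * (a * q - q * a - (b * p - p * b)) - (a * q - q * a - (b * p - p * b)) * r)) := by
  noncomm_ring

/-- Keeping the identity in the tensor product allows it to be evaluated under products of operators
that do not commute, such as `α` with `mulLin`. -/
theorem bilin_cyclic_eq_zero (P : Γ → LinBivector V)
    (hP : ∀ γ x y z, P γ x y ⊗ₜ[ℝ] (ρ.dual γ z - z) + P γ y z ⊗ₜ[ℝ] (ρ.dual γ x - x) +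
      P γ z x ⊗ₜ[ℝ] (ρ.dual γ y - y) = 0) {E : Type*} [AddCommGroup E] [Module ℝ E]
    (B : Module.Dual ℝ V →ₗ[ℝ] Module.Dual ℝ V →ₗ[ℝ] E) (γ : Γ) (x y z : Module.Dual ℝ V) :
    B (P γ x y) (ρ.dual γ z - z) + B (P γ y z) (ρ.dual γ x - x) +
      B (P γ z x) (ρ.dual γ y - y) = 0 := by
  have := congrArg (TensorProduct.lift B) (hP γ x y z)
  rwa [map_add, map_add, map_zero, TensorProduct.lift.tmul, TensorProduct.lift.tmul,
    TensorProduct.lift.tmul] at this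

/-- The commutator of the values of an operator valued one-form. -/
def selfComm (α : Module.Dual ℝ V →ₗ[ℝ] Module.End ℝ (Crossed ρ)) :
    Module.Dual ℝ V →ₗ[ℝ] Module.Dual ℝ V →ₗ[ℝ] Module.End ℝ (Crossed ρ) :=
  LinearMap.mk₂ ℝ (fun x y => α x * α y - α y * α x)
    (fun x x' y => by simp only [map_add, mul_add, add_mul]; abel)
    (fun r x y => by simp only [map_smul, smul_mul_assoc, mul_smul_comm, smul_sub])
    (fun x y y' => by simp only [map_add, mul_add, add_mul]; abel)
    (fun r x y => by simp only [map_smul, smul_mul_assoc, mul_smul_comm, smul_sub])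

theorem selfComm_apply (α : Module.Dual ℝ V →ₗ[ℝ] Module.End ℝ (Crossed ρ))
    (x y : Module.Dual ℝ V) : selfComm ρ α x y = α x * α y - α y * α x := rfl

theorem mulGrp_mul_selfComm (α : Module.Dual ℝ V →ₗ[ℝ] Module.End ℝ (Crossed ρ))
    (hα : ∀ g x, mulGrp ρ g * α x = α (ρ.dual g x) * mulGrp ρ g) (g : Γ) (x y : Module.Dual ℝ V) :
    mulGrp ρ g * selfComm ρ α x y = selfComm ρ α (ρ.dual g x) (ρ.dual g y) * mulGrp ρ g := by
  have h : ∀ x y, mulGrp ρ g * (α x * α y) = α (ρ.dual g x) * α (ρ.dual g y) * mulGrp ρ g :=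
    fun x y => by rw [← mul_assoc, hα, mul_assoc, hα, mul_assoc]
  rw [selfComm_apply, selfComm_apply, mul_sub, sub_mul, h, h]

variable [Fintype Γ] (P : Γ → LinBivector V)

/-- The operator valued two-form `∑ γ, φ (P γ x y) γ` built from an operator valued one-form. -/
def pairForm (φ : Module.Dual ℝ V →ₗ[ℝ] Module.End ℝ (Crossed ρ)) :
    Module.Dual ℝ V →ₗ[ℝ] Module.Dual ℝ V →ₗ[ℝ] Module.End ℝ (Crossed ρ) :=
  ∑ γ, (P γ).compr₂ (LinearMap.mulRight ℝ (mulGrp ρ γ) ∘ₗ φ)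

theorem pairForm_apply (φ : Module.Dual ℝ V →ₗ[ℝ] Module.End ℝ (Crossed ρ))
    (x y : Module.Dual ℝ V) : pairForm ρ P φ x y = ∑ γ, φ (P γ x y) * mulGrp ρ γ := by
  simp [pairForm]

theorem mulGrp_mul_pairForm (φ : Module.Dual ℝ V →ₗ[ℝ] Module.End ℝ (Crossed ρ))
    (hφ : ∀ g x, mulGrp ρ g * φ x = φ (ρ.dual g x) * mulGrp ρ g)
    (hP : ∀ g γ x y, ρ.dual g (P γ x y) = P (g * γ * g⁻¹) (ρ.dual g x) (ρ.dual g y))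
    (g : Γ) (x y : Module.Dual ℝ V) :
    mulGrp ρ g * pairForm ρ P φ x y =
      pairForm ρ P φ (ρ.dual g x) (ρ.dual g y) * mulGrp ρ g := by
  rw [pairForm_apply, pairForm_apply, Finset.mul_sum, Finset.sum_mul]
  refine Fintype.sum_equiv (MulAut.conj g).toEquiv _ _ fun γ => ?_
  rw [← mul_assoc, hφ, hP, MulEquiv.toEquiv_eq_coe, EquivLike.coe_coe, MulAut.conj_apply,
    mul_assoc (φ _), mul_assoc (φ _), ← mulGrp_mul, ← mulGrp_mul, inv_mul_cancel_right]

/-- The operator valued two-form `∑ γ, κ γ x y γ`. -/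
def scalarForm (κ : Γ → Module.Dual ℝ V →ₗ[ℝ] Module.Dual ℝ V →ₗ[ℝ] ℝ) :
    Module.Dual ℝ V →ₗ[ℝ] Module.Dual ℝ V →ₗ[ℝ] Module.End ℝ (Crossed ρ) :=
  ∑ γ, (κ γ).compr₂ (LinearMap.toSpanSingleton ℝ _ (mulGrp ρ γ))

theorem scalarForm_apply (κ : Γ → Module.Dual ℝ V →ₗ[ℝ] Module.Dual ℝ V →ₗ[ℝ] ℝ)
    (x y : Module.Dual ℝ V) : scalarForm ρ κ x y = ∑ γ, κ γ x y • mulGrp ρ γ := by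
  simp [scalarForm]

theorem mulGrp_mul_scalarForm (κ : Γ → Module.Dual ℝ V →ₗ[ℝ] Module.Dual ℝ V →ₗ[ℝ] ℝ)
    (hκ : ∀ g γ x y, κ (g * γ * g⁻¹) (ρ.dual g x) (ρ.dual g y) = κ γ x y)
    (g : Γ) (x y : Module.Dual ℝ V) :
    mulGrp ρ g * scalarForm ρ κ x y =
      scalarForm ρ κ (ρ.dual g x) (ρ.dual g y) * mulGrp ρ g := by
  rw [scalarForm_apply, scalarForm_apply, Finset.mul_sum, Finset.sum_mul]
  refine Fintype.sum_equiv (MulAut.conj g).toEquiv _ _ fun γ => ?_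
  rw [MulEquiv.toEquiv_eq_coe, EquivLike.coe_coe, MulAut.conj_apply, hκ, mul_smul_comm,
    smul_mul_assoc, ← mulGrp_mul, ← mulGrp_mul, inv_mul_cancel_right]

/-- Commuting `x` past `γ` leaves the factor `x - γx`, so the differential is minus the cyclic sum
that `hP` kills. -/
theorem pairForm_mulLin_closed
    (hP : ∀ γ x y z, P γ x y ⊗ₜ[ℝ] (ρ.dual γ z - z) + P γ y z ⊗ₜ[ℝ] (ρ.dual γ x - x) +
      P γ z x ⊗ₜ[ℝ] (ρ.dual γ y - y) = 0) (x y z : Module.Dual ℝ V) :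
    commLin ρ x (pairForm ρ P (mulLin ρ) y z) + commLin ρ y (pairForm ρ P (mulLin ρ) z x) +
      commLin ρ z (pairForm ρ P (mulLin ρ) x y) = 0 := by
  simp only [pairForm_apply, map_sum, ← Finset.sum_add_distrib, commLin_mul_mulGrp, ← add_mul]
  refine Finset.sum_eq_zero fun γ _ => ?_
  have h := bilin_cyclic_eq_zero ρ P hP
    ((LinearMap.mul ℝ (Module.End ℝ (Crossed ρ))).compl₁₂ (mulLin ρ) (mulLin ρ)) γ x y z
  simp only [LinearMap.compl₁₂_apply, LinearMap.mul_apply', map_sub] at h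
  convert zero_mul _
  rw [mulLin_comm ρ x (P γ y z), mulLin_comm ρ y (P γ z x),
    mulLin_comm ρ z (P γ x y), ← neg_eq_zero, ← h]
  abel

/-- The operator valued two-form whose primitives are the second order terms of the deformation. -/
def secondOrderForm (κ : Γ → Module.Dual ℝ V →ₗ[ℝ] Module.Dual ℝ V →ₗ[ℝ] ℝ)
    (α : Module.Dual ℝ V →ₗ[ℝ] Module.End ℝ (Crossed ρ)) :
    Module.Dual ℝ V →ₗ[ℝ] Module.Dual ℝ V →ₗ[ℝ] Module.End ℝ (Crossed ρ) :=
  LinearMap.mk₂ ℝ (fun x y => pairForm ρ P α x y - selfComm ρ α x y - scalarForm ρ κ x y)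
    (fun x x' y => by simp only [map_add, LinearMap.add_apply]; abel)
    (fun r x y => by simp only [map_smul, LinearMap.smul_apply, smul_sub])
    (fun x y y' => by simp only [map_add]; abel)
    (fun r x y => by simp only [map_smul, smul_sub])

theorem secondOrderForm_apply (κ : Γ → Module.Dual ℝ V →ₗ[ℝ] Module.Dual ℝ V →ₗ[ℝ] ℝ)
    (α : Module.Dual ℝ V →ₗ[ℝ] Module.End ℝ (Crossed ρ)) (x y : Module.Dual ℝ V) :
    secondOrderForm ρ P κ α x y =
      pairForm ρ P α x y - selfComm ρ α x y - scalarForm ρ κ x y := rfl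

/-- Combining the differentials of the pairing and of `[α, α]`, the twist terms `γx - x` cancel by
`hP1` and the remaining terms form the Jacobi expression of `P`. By `hP2` this is exactly the
differential of the scalar term. -/
theorem secondOrderForm_closed
    (hP1 : ∀ γ x y z, P γ x y ⊗ₜ[ℝ] (ρ.dual γ z - z) + P γ y z ⊗ₜ[ℝ] (ρ.dual γ x - x) +
      P γ z x ⊗ₜ[ℝ] (ρ.dual γ y - y) = 0)
    (hPa : ∀ γ x y, P γ x y = -P γ y x)
    (κ : Γ → Module.Dual ℝ V →ₗ[ℝ] Module.Dual ℝ V →ₗ[ℝ] ℝ)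
    (hP2 : ∀ σ x y z, ∑ γ, (P (σ * γ⁻¹) (P γ x y) z + P (σ * γ⁻¹) (P γ y z) x +
        P (σ * γ⁻¹) (P γ z x) y) =
      κ σ x y • (ρ.dual σ z - z) + κ σ y z • (ρ.dual σ x - x) + κ σ z x • (ρ.dual σ y - y))
    (α : Module.Dual ℝ V →ₗ[ℝ] Module.End ℝ (Crossed ρ))
    (hαE : ∀ g x, mulGrp ρ g * α x = α (ρ.dual g x) * mulGrp ρ g)
    (hα : ∀ x y, commLin ρ x (α y) - commLin ρ y (α x) = pairForm ρ P (mulLin ρ) x y)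
    (x y z : Module.Dual ℝ V) :
    commLin ρ x (secondOrderForm ρ P κ α y z) + commLin ρ y (secondOrderForm ρ P κ α z x) +
      commLin ρ z (secondOrderForm ρ P κ α x y) = 0 := by
  -- the commutators of `α` with itself
  have e1 : ∀ x y z, α x * (commLin ρ y (α z) - commLin ρ z (α y)) -
      (commLin ρ y (α z) - commLin ρ z (α y)) * α x =
      ∑ γ, (α x * mulLin ρ (P γ y z) - mulLin ρ (P γ y z) * α (ρ.dual γ x)) * mulGrp ρ γ := by
    intro x y z
    rw [hα, pairForm_apply, Finset.mul_sum, Finset.sum_mul, ← Finset.sum_sub_distrib]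
    refine Finset.sum_congr rfl fun γ _ => ?_
    rw [mul_assoc (mulLin ρ (P γ y z)), hαE, sub_mul, mul_assoc, mul_assoc]
  have e2 := commutator_jacobi (mulLin ρ x) (mulLin ρ y) (mulLin ρ z) (α x) (α y) (α z)
  have e3 := e1 x y z
  have e4 := e1 y z x
  have e5 := e1 z x y
  simp only [commLin_apply] at e3 e4 e5
  rw [e3, e4, e5] at e2
  have e6 : commLin ρ x (selfComm ρ α y z) + commLin ρ y (selfComm ρ α z x) +
      commLin ρ z (selfComm ρ α x y) = _ := e2
  -- the pairing with `α`
  have f1 : ∀ x y z γ, (mulLin ρ x * α (P γ y z) - α (P γ y z) * mulLin ρ (ρ.dual γ x)) +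
      (α x * mulLin ρ (P γ y z) - mulLin ρ (P γ y z) * α (ρ.dual γ x)) =
      (∑ δ, mulLin ρ (P δ x (P γ y z)) * mulGrp ρ δ) -
        (α (P γ y z) * mulLin ρ (ρ.dual γ x - x) + mulLin ρ (P γ y z) * α (ρ.dual γ x - x)) := by
    intro x y z γ
    rw [← pairForm_apply, ← hα]
    simp only [commLin_apply, map_sub, mul_sub]
    abel
  have f2 : ∀ γ, (α (P γ x y) * mulLin ρ (ρ.dual γ z - z) +
        mulLin ρ (P γ x y) * α (ρ.dual γ z - z)) +
      (α (P γ y z) * mulLin ρ (ρ.dual γ x - x) + mulLin ρ (P γ y z) * α (ρ.dual γ x - x)) +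
      (α (P γ z x) * mulLin ρ (ρ.dual γ y - y) + mulLin ρ (P γ z x) * α (ρ.dual γ y - y)) = 0 :=
    fun γ => bilin_cyclic_eq_zero ρ P hP1
      ((LinearMap.mul ℝ (Module.End ℝ (Crossed ρ))).compl₁₂ α (mulLin ρ) +
        (LinearMap.mul ℝ (Module.End ℝ (Crossed ρ))).compl₁₂ (mulLin ρ) α) γ x y z
  -- Reindexed by `σ = δ γ`; the sign comes from moving `x` into the second argument.
  have f3 : ∀ x y z, ∑ γ, (∑ δ, mulLin ρ (P δ x (P γ y z)) * mulGrp ρ δ) * mulGrp ρ γ =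
      -∑ σ, mulLin ρ (∑ γ, P (σ * γ⁻¹) (P γ y z) x) * mulGrp ρ σ := by
    intro x y z
    simp only [map_sum, Finset.sum_mul]
    rw [Finset.sum_comm (s := Finset.univ (α := Γ)) (f := fun σ γ => mulLin ρ _ * mulGrp ρ σ),
      ← Finset.sum_neg_distrib]
    refine Finset.sum_congr rfl fun γ _ => ?_
    rw [← Finset.sum_neg_distrib]
    refine Fintype.sum_equiv (Equiv.mulRight γ) _ _ fun δ => ?_
    rw [Equiv.coe_mulRight, mul_inv_cancel_right, hPa, map_neg, mulGrp_mul]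
    exact neg_mul_mul_eq _ _ _
  -- the scalar part
  have g1 : ∀ x y z, commLin ρ x (scalarForm ρ κ y z) =
      -∑ σ, mulLin ρ (κ σ y z • (ρ.dual σ x - x)) * mulGrp ρ σ := by
    intro x y z
    rw [scalarForm_apply, map_sum, ← Finset.sum_neg_distrib]
    refine Finset.sum_congr rfl fun σ _ => ?_
    rw [← one_mul (mulGrp ρ σ), ← smul_mul_assoc, commLin_mul_mulGrp, map_smul, map_sub]
    simp only [smul_mul_assoc, mul_smul_comm, one_mul, mul_one, neg_sub, smul_sub, sub_mul]
  have key : ∑ σ, mulLin ρ (∑ γ, P (σ * γ⁻¹) (P γ y z) x) * mulGrp ρ σ +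
      ∑ σ, mulLin ρ (∑ γ, P (σ * γ⁻¹) (P γ z x) y) * mulGrp ρ σ +
      ∑ σ, mulLin ρ (∑ γ, P (σ * γ⁻¹) (P γ x y) z) * mulGrp ρ σ =
      ∑ σ, mulLin ρ (κ σ y z • (ρ.dual σ x - x)) * mulGrp ρ σ +
      ∑ σ, mulLin ρ (κ σ z x • (ρ.dual σ y - y)) * mulGrp ρ σ +
      ∑ σ, mulLin ρ (κ σ x y • (ρ.dual σ z - z)) * mulGrp ρ σ := by
    simp only [← Finset.sum_add_distrib, ← add_mul, ← map_add]
    refine Finset.sum_congr rfl fun σ _ => ?_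
    have := hP2 σ y z x
    rw [add_right_comm] at this
    rw [this, add_right_comm]
  have f4 : commLin ρ x (pairForm ρ P α y z) + commLin ρ y (pairForm ρ P α z x) +
      commLin ρ z (pairForm ρ P α x y) - (commLin ρ x (selfComm ρ α y z) +
      commLin ρ y (selfComm ρ α z x) + commLin ρ z (selfComm ρ α x y)) =
      (∑ γ, (∑ δ, mulLin ρ (P δ x (P γ y z)) * mulGrp ρ δ) * mulGrp ρ γ) +
      (∑ γ, (∑ δ, mulLin ρ (P δ y (P γ z x)) * mulGrp ρ δ) * mulGrp ρ γ) +
      (∑ γ, (∑ δ, mulLin ρ (P δ z (P γ x y)) * mulGrp ρ δ) * mulGrp ρ γ) := by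
    rw [e6, sub_neg_eq_add]
    simp only [pairForm_apply, map_sum, commLin_mul_mulGrp, ← Finset.sum_add_distrib]
    refine Finset.sum_congr rfl fun γ _ => ?_
    rw [← add_mul, ← add_mul, ← add_mul, ← add_mul, ← add_mul, ← add_mul, ← add_mul]
    congr 1
    have h1 := f1 x y z γ
    have h2 := f1 y z x γ
    have h3 := f1 z x y γ
    have h4 := f2 γ
    rw [eq_sub_iff_add_eq] at h1 h2 h3
    rw [← h1, ← h2, ← h3, ← sub_eq_zero]
    rw [← neg_eq_zero, ← h4]
    abel
  simp only [secondOrderForm_apply, map_sub]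
  rw [f3, f3, f3] at f4
  rw [g1, g1, g1]
  exact cyclic_sum_eq_zero f4 key

/-- An equivariant family of linear bivectors that satisfies the Jacobi identities up to scalar
terms is the first order part of an associative deformation of the crossed product modulo `t³`. -/
theorem exists_twoCochains [FiniteDimensional ℝ V] (hP : ∀ γ x, P γ x x = 0)
    (hPE : ∀ g γ x y, ρ.dual g (P γ x y) = P (g * γ * g⁻¹) (ρ.dual g x) (ρ.dual g y))
    (κ : Γ → Module.Dual ℝ V →ₗ[ℝ] Module.Dual ℝ V →ₗ[ℝ] ℝ) (hκ : ∀ γ x, κ γ x x = 0)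
    (hκE : ∀ g γ x y, κ (g * γ * g⁻¹) (ρ.dual g x) (ρ.dual g y) = κ γ x y)
    (hP1 : ∀ γ x y z, P γ x y ⊗ₜ[ℝ] (ρ.dual γ z - z) + P γ y z ⊗ₜ[ℝ] (ρ.dual γ x - x) +
      P γ z x ⊗ₜ[ℝ] (ρ.dual γ y - y) = 0)
    (hP2 : ∀ σ x y z, ∑ γ, (P (σ * γ⁻¹) (P γ x y) z + P (σ * γ⁻¹) (P γ y z) x +
        P (σ * γ⁻¹) (P γ z x) y) =
      κ σ x y • (ρ.dual σ z - z) + κ σ y z • (ρ.dual σ x - x) + κ σ z x • (ρ.dual σ y - y)) :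
    ∃ f h : TwoCochain (Crossed ρ), IsTwoCocycle f ∧
      (∀ g a b, f (grp ρ g * a) b = grp ρ g * f a b) ∧
      (∀ g a b, f (a * grp ρ g) b = f a (grp ρ g * b)) ∧
      (∀ g a b, f a (b * grp ρ g) = f a b * grp ρ g) ∧
      (∀ x y, f (lin ρ x) (lin ρ y) - f (lin ρ y) (lin ρ x) =
        ∑ γ, lin ρ (P γ x y) * grp ρ γ) ∧
      ∀ a b c, circ f f a b c = hochschildD h a b c := by
  have hPa : ∀ γ x y, P γ x y = -P γ y x := fun γ x y => by
    have := hP γ (x + y)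
    simp only [map_add, LinearMap.add_apply, hP, zero_add, add_zero] at this
    exact eq_neg_of_add_eq_zero_right this
  have hpairR : ∀ φ : Module.Dual ℝ V →ₗ[ℝ] Module.End ℝ (Crossed ρ),
      (∀ x, φ x ∈ rightLinear ρ) → ∀ x y, pairForm ρ P φ x y ∈ rightLinear ρ := by
    intro φ hφ x y
    rw [pairForm_apply]
    exact sum_mem fun γ _ => mul_mem (hφ _) (mulGrp_mem_rightLinear ρ γ)
  have hpair0 : ∀ (φ : Module.Dual ℝ V →ₗ[ℝ] Module.End ℝ (Crossed ρ)) x, pairForm ρ P φ x x = 0 := by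
    intro φ x
    rw [pairForm_apply]
    exact Finset.sum_eq_zero fun γ _ => by rw [hP, map_zero, zero_mul]
  obtain ⟨α, hαR, hα1, hαE, hα⟩ := exists_equivariant_koszulD_eq ρ (pairForm ρ P (mulLin ρ))
    (hpair0 _) (hpairR _ (mulLin_mem_rightLinear ρ)) (pairForm_mulLin_closed ρ P hP1)
    (mulGrp_mul_pairForm ρ P _ (mulGrp_mul_mulLin ρ) hPE)
  obtain ⟨β, hβR, hβ1, hβE, hβ⟩ := exists_equivariant_koszulD_eq ρ (secondOrderForm ρ P κ α)
    (fun x => by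
      rw [secondOrderForm_apply, hpair0, selfComm_apply, scalarForm_apply, sub_self, sub_self,
        zero_sub, neg_eq_zero]
      exact Finset.sum_eq_zero fun γ _ => by rw [hκ, zero_smul])
    (fun x y => by
      rw [secondOrderForm_apply, selfComm_apply, scalarForm_apply]
      exact sub_mem (sub_mem (hpairR _ hαR x y) (sub_mem (mul_mem (hαR x) (hαR y))
        (mul_mem (hαR y) (hαR x))))
        (sum_mem fun γ _ => Subalgebra.smul_mem _ (mulGrp_mem_rightLinear ρ γ) _))
    (secondOrderForm_closed ρ P hP1 hPa κ hP2 α hαE hα)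
    (fun g x y => by
      rw [secondOrderForm_apply, secondOrderForm_apply, mul_sub, mul_sub, sub_mul, sub_mul,
        mulGrp_mul_pairForm ρ P α hαE hPE, mulGrp_mul_selfComm ρ α hαE,
        mulGrp_mul_scalarForm ρ κ hκE])
  refine exists_twoCochains_of_operators ρ P (fun γ x y => κ γ x y) α β hαR hβR hα1 hβ1 hαE hβE
    (fun x y => by rw [hα, pairForm_apply]) (fun x y => ?_)
  rw [hβ, secondOrderForm_apply, pairForm_apply, selfComm_apply, scalarForm_apply]

end CrossedProduct
end
end CrossedPoisson

namespace CrossedPoisson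

open scoped InnerProductSpace

noncomputable section

section Volume

variable {W : Type*} [AddCommGroup W] [Module ℝ W]

/-! ### Four-forms -/

/-- The exterior product of four linear forms, evaluated at four vectors. -/
def vol4 (φ : Fin 4 → Module.Dual ℝ W) (a x y z : W) : ℝ :=
  (Matrix.of fun i j => φ i (![a, x, y, z] j)).det

theorem vol4_eq (φ : Fin 4 → Module.Dual ℝ W) (a x y z : W) : vol4 φ a x y z =
    (φ 0 a * φ 1 x - φ 0 x * φ 1 a) * (φ 2 y * φ 3 z - φ 2 z * φ 3 y) -
    (φ 0 a * φ 1 y - φ 0 y * φ 1 a) * (φ 2 x * φ 3 z - φ 2 z * φ 3 x) +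
    (φ 0 a * φ 1 z - φ 0 z * φ 1 a) * (φ 2 x * φ 3 y - φ 2 y * φ 3 x) +
    (φ 2 a * φ 3 x - φ 2 x * φ 3 a) * (φ 0 y * φ 1 z - φ 0 z * φ 1 y) -
    (φ 2 a * φ 3 y - φ 2 y * φ 3 a) * (φ 0 x * φ 1 z - φ 0 z * φ 1 x) +
    (φ 2 a * φ 3 z - φ 2 z * φ 3 a) * (φ 0 x * φ 1 y - φ 0 y * φ 1 x) := by
  simp [vol4, Matrix.det_succ_row_zero, Fin.sum_univ_succ, Fin.succAbove]
  ring

theorem vol4_add_left (φ : Fin 4 → Module.Dual ℝ W) (a b x y z : W) :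
    vol4 φ (a + b) x y z = vol4 φ a x y z + vol4 φ b x y z := by
  simp only [vol4_eq, map_add]; ring

theorem vol4_smul_left (φ : Fin 4 → Module.Dual ℝ W) (r : ℝ) (a x y z : W) :
    vol4 φ (r • a) x y z = r * vol4 φ a x y z := by
  simp only [vol4_eq, map_smul, smul_eq_mul]; ring

/-- The contraction of an exterior product of four linear forms with two vectors. -/
def vol4Contract (φ : Fin 4 → Module.Dual ℝ W) (a b : W) : W →ₗ[ℝ] W →ₗ[ℝ] ℝ :=
  LinearMap.mk₂ ℝ (vol4 φ a b)
    (fun x x' y => by simp only [vol4_eq, map_add]; ring)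
    (fun r x y => by simp only [vol4_eq, map_smul, smul_eq_mul]; ring)
    (fun x y y' => by simp only [vol4_eq, map_add]; ring)
    (fun r x y => by simp only [vol4_eq, map_smul, smul_eq_mul]; ring)

theorem vol4Contract_apply (φ : Fin 4 → Module.Dual ℝ W) (a b x y : W) :
    vol4Contract φ a b x y = vol4 φ a b x y := rfl

theorem vol4_self (φ : Fin 4 → Module.Dual ℝ W) (a b x : W) : vol4 φ a b x x = 0 := by
  rw [vol4_eq]; ring

/-- Forms that are linear combinations of four given ones have a proportional exterior product. -/
theorem vol4_of_combination (φ ψ : Fin 4 → Module.Dual ℝ W) (C : Matrix (Fin 4) (Fin 4) ℝ)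
    (h : ∀ i, ψ i = ∑ j, C i j • φ j) (a x y z : W) :
    vol4 ψ a x y z = C.det * vol4 φ a x y z := by
  rw [vol4, vol4, ← Matrix.det_mul]
  congr 1
  ext i j
  simp [h, Matrix.mul_apply]

/-- The Plücker relation among five vectors. -/
theorem apply_plucker (φ : Fin 4 → Module.Dual ℝ W) (a b x y z : W) (i : Fin 4) :
    φ i (vol4 φ a b x y • z + vol4 φ a b y z • x + vol4 φ a b z x • y -
      (vol4 φ a x y z • b - vol4 φ b x y z • a)) = 0 := by
  simp only [map_add, map_sub, map_smul, smul_eq_mul, vol4_eq]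
  fin_cases i <;> simp only [Fin.reduceFinMk, Fin.zero_eta, Fin.mk_one] <;> ring

/-- Linear forms with nonzero exterior product take arbitrary values. -/
theorem exists_apply_eq_of_vol4_ne_zero (φ : Fin 4 → Module.Dual ℝ W) {a x y z : W}
    (h : vol4 φ a x y z ≠ 0) (t : Fin 4 → ℝ) : ∃ v, ∀ i, φ i v = t i := by
  set M : Matrix (Fin 4) (Fin 4) ℝ := Matrix.of fun i j => φ i (![a, x, y, z] j) with hM
  have hu : IsUnit M.det := isUnit_iff_ne_zero.2 h
  refine ⟨∑ j, (M⁻¹.mulVec t) j • ![a, x, y, z] j, fun i => ?_⟩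
  have : (M.mulVec (M⁻¹.mulVec t)) i = t i := by
    rw [Matrix.mulVec_mulVec, Matrix.mul_nonsing_inv _ hu, Matrix.one_mulVec]
  rw [← this, map_sum, Matrix.mulVec, dotProduct]
  refine Finset.sum_congr rfl fun j _ => ?_
  rw [map_smul, smul_eq_mul, mul_comm, hM, Matrix.of_apply]

/-- A generalised inverse, obtained by extending a section of `τ` over its range. It is used for `τ
= σ - 1`. -/
theorem exists_comp_comp_eq (τ : W →ₗ[ℝ] W) : ∃ θ : W →ₗ[ℝ] W, ∀ x, τ (θ (τ x)) = τ x := by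
  obtain ⟨g, hg⟩ := τ.rangeRestrict.exists_rightInverse_of_surjective τ.range_rangeRestrict
  obtain ⟨θ, hθ⟩ := g.exists_extend
  refine ⟨θ, fun x => ?_⟩
  have h1 : θ (τ x) = g ⟨τ x, x, rfl⟩ := LinearMap.congr_fun hθ ⟨τ x, x, rfl⟩
  rw [h1]
  exact congrArg Subtype.val (LinearMap.congr_fun hg ⟨τ x, x, rfl⟩)

end Volume

/-! ### Factorisations of a group element and their four-forms -/

section Scalar

variable {Γ : Type*} [Group Γ] {W : Type*} [AddCommGroup W] [Module ℝ W]
  (r : Representation ℝ Γ W)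

theorem rep_inv_apply (g : Γ) (x : W) : r g⁻¹ (r g x) = x := by
  rw [← Module.End.mul_apply, ← map_mul, inv_mul_cancel, map_one, Module.End.one_apply]

theorem rep_apply_inv (g : Γ) (x : W) : r g (r g⁻¹ x) = x := by
  rw [← Module.End.mul_apply, ← map_mul, mul_inv_cancel, map_one, Module.End.one_apply]

/-- The average of a sum of squares of coordinates; definiteness is visible in the summand `g = 1`.
-/
theorem exists_invariant_form [Fintype Γ] [FiniteDimensional ℝ W] :
    ∃ β : W →ₗ[ℝ] W →ₗ[ℝ] ℝ, (∀ g x y, β (r g x) (r g y) = β x y) ∧ ∀ x, β x x = 0 → x = 0 := by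
  let b := Module.finBasis ℝ W
  let β : W →ₗ[ℝ] W →ₗ[ℝ] ℝ :=
    ∑ g, ∑ i, (LinearMap.mul ℝ ℝ).compl₁₂ (b.coord i ∘ₗ r g) (b.coord i ∘ₗ r g)
  have hβ : ∀ x y, β x y = ∑ g, ∑ i, b.coord i (r g x) * b.coord i (r g y) := fun x y => by
    simp [β]
  refine ⟨β, fun h x y => ?_, fun x hx => ?_⟩
  · rw [hβ, hβ]
    refine Fintype.sum_equiv (Equiv.mulRight h) _ _ fun g => ?_
    rw [Equiv.coe_mulRight, map_mul, Module.End.mul_apply, Module.End.mul_apply]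
  · rw [hβ] at hx
    have h1 := (Finset.sum_eq_zero_iff_of_nonneg fun g _ =>
      Finset.sum_nonneg fun i _ => mul_self_nonneg _).1 hx 1 (Finset.mem_univ _)
    refine b.forall_coord_eq_zero_iff.1 fun i => ?_
    have h2 := (Finset.sum_eq_zero_iff_of_nonneg fun i _ => mul_self_nonneg _).1 h1 i
      (Finset.mem_univ _)
    rw [map_one, Module.End.one_apply] at h2
    exact mul_self_eq_zero.1 h2

variable (p q : Γ → Module.Dual ℝ W)

/-- The four linear forms attached to a factorisation `σ = (σ γ⁻¹) γ`. -/
def fourForms (σ γ : Γ) : Fin 4 → Module.Dual ℝ W := ![p γ, q γ, p (σ * γ⁻¹), q (σ * γ⁻¹)]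

theorem vol4_fourForms (σ γ : Γ) (a x y z : W) : vol4 (fourForms p q σ γ) a x y z =
    (p γ a * q γ x - p γ x * q γ a) *
      (p (σ * γ⁻¹) y * q (σ * γ⁻¹) z - p (σ * γ⁻¹) z * q (σ * γ⁻¹) y) -
    (p γ a * q γ y - p γ y * q γ a) *
      (p (σ * γ⁻¹) x * q (σ * γ⁻¹) z - p (σ * γ⁻¹) z * q (σ * γ⁻¹) x) +
    (p γ a * q γ z - p γ z * q γ a) *
      (p (σ * γ⁻¹) x * q (σ * γ⁻¹) y - p (σ * γ⁻¹) y * q (σ * γ⁻¹) x) +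
    (p (σ * γ⁻¹) a * q (σ * γ⁻¹) x - p (σ * γ⁻¹) x * q (σ * γ⁻¹) a) *
      (p γ y * q γ z - p γ z * q γ y) -
    (p (σ * γ⁻¹) a * q (σ * γ⁻¹) y - p (σ * γ⁻¹) y * q (σ * γ⁻¹) a) *
      (p γ x * q γ z - p γ z * q γ x) +
    (p (σ * γ⁻¹) a * q (σ * γ⁻¹) z - p (σ * γ⁻¹) z * q (σ * γ⁻¹) a) *
      (p γ x * q γ y - p γ y * q γ x) :=
  vol4_eq _ _ _ _ _

/-- If the four forms attached to `σ = (σ γ⁻¹) γ` are independent, they vanish on the vectors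
fixed by `σ`. -/
theorem fourForms_eq_zero_of_fixed [Fintype Γ] [FiniteDimensional ℝ W]
    (hfix : ∀ γ z, r γ z = z → p γ z = 0 ∧ q γ z = 0)
    (hmove : ∀ γ, p γ = 0 ∨ ∃ m m' : W, ∀ z, r γ z = z + p γ z • m + q γ z • m')
    {σ γ : Γ} {a b c d : W} (hv : vol4 (fourForms p q σ γ) a b c d ≠ 0) {z : W} (hz : r σ z = z)
    (i : Fin 4) : fourForms p q σ γ i z = 0 := by
  obtain ⟨β, hβr, hβ0⟩ := exists_invariant_form r
  have hp1 : p γ ≠ 0 := fun h => hv (by rw [vol4_fourForms]; simp [h])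
  have hp2 : p (σ * γ⁻¹) ≠ 0 := fun h => hv (by rw [vol4_fourForms]; simp [h])
  obtain ⟨m₁, m₁', h1⟩ := (hmove γ).resolve_left hp1
  obtain ⟨m₂, m₂', h2⟩ := (hmove (σ * γ⁻¹)).resolve_left hp2
  have e1 : r (σ * γ⁻¹) (r γ z) = z := by
    rw [← Module.End.mul_apply, ← map_mul, inv_mul_cancel_right, hz]
  have e2 : r γ z = r (σ * γ⁻¹)⁻¹ z := by
    conv_rhs => rw [← e1, rep_inv_apply]
  have hker : ∀ g f, r g f = f → β (r g z - z) f = 0 := fun g f hf => by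
    rw [map_sub, LinearMap.sub_apply]
    nth_rw 1 [← hf]
    rw [hβr, sub_self]
  -- Let `n = γz - z`, which is also `(σγ⁻¹)⁻¹z - z`; so `n` is orthogonal to the vectors fixed by
  -- `γ` and to those fixed by `(σγ⁻¹)⁻¹`. Independence of the four forms splits `n = (n - v) + v`
  -- into two such vectors, whence `β(n, n) = 0`.
  have hn : r γ z - z = 0 := by
    refine hβ0 _ ?_
    obtain ⟨v, hv⟩ := exists_apply_eq_of_vol4_ne_zero _ hv
      ![p γ (r γ z - z), q γ (r γ z - z), 0, 0]
    have v0 : p γ v = p γ (r γ z - z) := hv 0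
    have v1 : q γ v = q γ (r γ z - z) := hv 1
    have v2 : p (σ * γ⁻¹) v = 0 := hv 2
    have v3 : q (σ * γ⁻¹) v = 0 := hv 3
    have f1 : r γ (r γ z - z - v) = r γ z - z - v := by
      rw [h1, map_sub (p γ) _ v, map_sub (q γ) _ v, v0, v1]; simp
    have f2 : r (σ * γ⁻¹)⁻¹ v = v := by
      have : r (σ * γ⁻¹) v = v := by rw [h2, v2, v3]; simp
      nth_rw 1 [← this]
      rw [rep_inv_apply]
    have k1 := hker _ _ f1
    have k2 := hker _ _ f2
    rw [← e2] at k2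
    rwa [map_sub, k2, sub_zero] at k1
  have hz1 : r γ z = z := sub_eq_zero.1 hn
  rw [hz1] at e1
  have g1 := hfix _ _ hz1
  have g2 := hfix _ _ e1
  fin_cases i
  exacts [g1.1, g1.2, g2.1, g2.2]

theorem fixed_of_fourForms_eq_zero
    (hmove : ∀ γ, p γ = 0 ∨ ∃ m m' : W, ∀ z, r γ z = z + p γ z • m + q γ z • m')
    {σ γ : Γ} {a b c d : W} (hv : vol4 (fourForms p q σ γ) a b c d ≠ 0) {z : W}
    (hz : ∀ i, fourForms p q σ γ i z = 0) : r σ z = z := by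
  have hp1 : p γ ≠ 0 := fun h => hv (by rw [vol4_fourForms]; simp [h])
  have hp2 : p (σ * γ⁻¹) ≠ 0 := fun h => hv (by rw [vol4_fourForms]; simp [h])
  obtain ⟨m₁, m₁', h1⟩ := (hmove γ).resolve_left hp1
  obtain ⟨m₂, m₂', h2⟩ := (hmove (σ * γ⁻¹)).resolve_left hp2
  have z0 : p γ z = 0 := hz 0
  have z1 : q γ z = 0 := hz 1
  have z2 : p (σ * γ⁻¹) z = 0 := hz 2
  have z3 : q (σ * γ⁻¹) z = 0 := hz 3
  have e1 : r γ z = z := by rw [h1, z0, z1]; simp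
  have e2 : r (σ * γ⁻¹) z = z := by rw [h2, z2, z3]; simp
  have : r σ z = r (σ * γ⁻¹) (r γ z) := by
    rw [← Module.End.mul_apply, ← map_mul, inv_mul_cancel_right]
  rw [this, e1, e2]

/-- The four-forms attached to the factorisations of `σ` are proportional. -/
theorem exists_vol4_fourForms_eq [Fintype Γ] [FiniteDimensional ℝ W]
    (hfix : ∀ γ z, r γ z = z → p γ z = 0 ∧ q γ z = 0)
    (hmove : ∀ γ, p γ = 0 ∨ ∃ m m' : W, ∀ z, r γ z = z + p γ z • m + q γ z • m')
    {σ γ₀ : Γ} {a b c d : W} (hv : vol4 (fourForms p q σ γ₀) a b c d ≠ 0) (γ : Γ) :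
    ∃ k : ℝ, ∀ a x y z, vol4 (fourForms p q σ γ) a x y z =
      k * vol4 (fourForms p q σ γ₀) a x y z := by
  by_cases h0 : ∀ a x y z, vol4 (fourForms p q σ γ) a x y z = 0
  · exact ⟨0, fun a x y z => by rw [h0, zero_mul]⟩
  push Not at h0
  obtain ⟨a', b', c', d', hv'⟩ := h0
  -- Both families are independent, so their common kernels are the space fixed by `σ`; forms that
  -- vanish on the common kernel of the reference family lie in its span.
  have hspan : ∀ i, ∃ C : Fin 4 → ℝ, ∑ j, C j • fourForms p q σ γ₀ j = fourForms p q σ γ i := by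
    intro i
    refine (Submodule.mem_span_range_iff_exists_fun ℝ).1 (mem_span_of_iInf_ker_le_ker fun z hz => ?_)
    rw [LinearMap.mem_ker]
    refine fourForms_eq_zero_of_fixed r p q hfix hmove hv'
      (fixed_of_fourForms_eq_zero r p q hmove hv fun j => ?_) i
    exact (Submodule.mem_iInf _).1 hz j
  choose C hC using hspan
  exact ⟨(Matrix.of C).det, vol4_of_combination _ _ _ fun i => (hC i).symm⟩

end Scalar
end
end CrossedPoisson

namespace CrossedPoisson

open scoped InnerProductSpace

noncomputable section

/-! ### Hurwitz moves and the scalar correction -/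

section Scalar

variable {Γ : Type*} [Group Γ] {W : Type*} [AddCommGroup W] [Module ℝ W]
  (r : Representation ℝ Γ W) (p q : Γ → Module.Dual ℝ W) (u : Γ → W)
  (B : Γ → W →ₗ[ℝ] W →ₗ[ℝ] W)

/-- The four-forms attached to two factorisations of `δ γ` that differ by a Hurwitz move. -/
theorem vol4_hurwitz
    (hB : ∀ γ x y, B γ x y = (p γ x * q γ y - p γ y * q γ x) • u γ)
    (hE : ∀ g γ x y, r g (B γ x y) = B (g * γ * g⁻¹) (r g x) (r g y))
    (hmove : ∀ γ, p γ = 0 ∨ ∃ m m' : W, ∀ z, r γ z = z + p γ z • m + q γ z • m')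
    (γ δ : Γ) (a x y z : W) :
    vol4 ![p δ, q δ, p (δ * γ * δ⁻¹), q (δ * γ * δ⁻¹)] a x y z • u (δ * γ * δ⁻¹) =
      vol4 ![p γ, q γ, p δ, q δ] a x y z • r δ (u γ) := by
  rcases hmove δ with h0 | ⟨m, m', hm⟩
  · simp [vol4_eq, h0]
  -- Modulo `p δ` and `q δ`, pulling back along `δ⁻¹` does nothing; the exterior product with `p δ ∧
  -- q δ` therefore removes the action of `δ`.
  obtain ⟨n, n', hinv⟩ : ∃ n n', ∀ s, r δ⁻¹ s = s - p δ s • n - q δ s • n' := by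
    refine ⟨r δ⁻¹ m, r δ⁻¹ m', fun s => ?_⟩
    have h1 := congrArg (r δ⁻¹) (hm s)
    rw [rep_inv_apply, map_add, map_add, map_smul, map_smul] at h1
    nth_rw 2 [h1]
    abel
  -- Equivariance controls only the product `(p ∧ q) u`, not its factors, so the comparison is
  -- carried out term by term with `u` attached.
  have hω : ∀ s t, (p (δ * γ * δ⁻¹) s * q (δ * γ * δ⁻¹) t -
      p (δ * γ * δ⁻¹) t * q (δ * γ * δ⁻¹) s) • u (δ * γ * δ⁻¹) =
      (p γ (r δ⁻¹ s) * q γ (r δ⁻¹ t) - p γ (r δ⁻¹ t) * q γ (r δ⁻¹ s)) • r δ (u γ) := fun s t => by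
    rw [← hB, ← map_smul, ← hB, hE, rep_apply_inv, rep_apply_inv]
  have hl : ∀ A s t, ((p (δ * γ * δ⁻¹) s * q (δ * γ * δ⁻¹) t -
      p (δ * γ * δ⁻¹) t * q (δ * γ * δ⁻¹) s) * A) • u (δ * γ * δ⁻¹) =
      ((p γ (r δ⁻¹ s) * q γ (r δ⁻¹ t) - p γ (r δ⁻¹ t) * q γ (r δ⁻¹ s)) * A) • r δ (u γ) :=
    fun A s t => by rw [mul_comm, mul_smul, hω, ← mul_smul, mul_comm]
  have hr : ∀ A s t, (A * (p (δ * γ * δ⁻¹) s * q (δ * γ * δ⁻¹) t -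
      p (δ * γ * δ⁻¹) t * q (δ * γ * δ⁻¹) s)) • u (δ * γ * δ⁻¹) =
      (A * (p γ (r δ⁻¹ s) * q γ (r δ⁻¹ t) - p γ (r δ⁻¹ t) * q γ (r δ⁻¹ s))) • r δ (u γ) :=
    fun A s t => by rw [mul_smul, hω, ← mul_smul]
  have e0 : vol4 ![p δ, q δ, p (δ * γ * δ⁻¹), q (δ * γ * δ⁻¹)] a x y z • u (δ * γ * δ⁻¹) =
      vol4 ![p δ, q δ, p γ ∘ₗ r δ⁻¹, q γ ∘ₗ r δ⁻¹] a x y z • r δ (u γ) := by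
    rw [vol4_eq, vol4_eq]
    change ((_ - _) * (p (δ * γ * δ⁻¹) _ * q (δ * γ * δ⁻¹) _ - _) - _ * _ + _ * _ +
      (p (δ * γ * δ⁻¹) _ * q (δ * γ * δ⁻¹) _ - _) * _ - _ * _ + _ * _) • _ =
      ((_ - _) * (p γ (r δ⁻¹ _) * q γ (r δ⁻¹ _) - _) - _ * _ + _ * _ +
      (p γ (r δ⁻¹ _) * q γ (r δ⁻¹ _) - _) * _ - _ * _ + _ * _) • _
    simp only [add_smul (M := W), sub_smul (_ * _ - _ * _ + _ * _ + _ * _) _ (_ : W),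
      sub_smul (_ * _) _ (_ : W)]
    congr 1
    · congr 1
      · congr 1
        · congr 1
          · congr 1
            · exact hr _ _ _
            · exact hr _ _ _
          · exact hr _ _ _
        · exact hl _ _ _
      · exact hl _ _ _
    · exact hl _ _ _
  rw [e0]
  congr 1
  simp only [vol4_eq, Matrix.cons_val, LinearMap.comp_apply, hinv, map_sub, map_smul, smul_eq_mul]
  ring

/-- Since `p γ` and `q γ` vanish on `u γ`, only three of the six terms of the four-form survive, and
they are the cyclic sum. -/
theorem cyclic_eq_vol4_smul
    (hB : ∀ γ x y, B γ x y = (p γ x * q γ y - p γ y * q γ x) • u γ)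
    (hu : ∀ γ, p γ (u γ) = 0 ∧ q γ (u γ) = 0) (σ γ : Γ) (x y z : W) :
    B (σ * γ⁻¹) (B γ x y) z + B (σ * γ⁻¹) (B γ y z) x + B (σ * γ⁻¹) (B γ z x) y =
      vol4 (fourForms p q σ γ) (u γ) x y z • u (σ * γ⁻¹) := by
  simp only [hB, map_smul, LinearMap.smul_apply, vol4_fourForms, (hu γ).1, (hu γ).2]
  module

variable [Fintype Γ]

/-- Reindexing by `γ ↦ σγ⁻¹` gives `∑ c_γ u_γ ⊗ u_{σγ⁻¹} = ∑ c_γ u_{σγ⁻¹} ⊗ σu_γ`. The claim uses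
this for `Λ` and for its flip. -/
theorem sum_hurwitz {U : Type*} [AddCommGroup U] [Module ℝ U] (σ : Γ) (c : Γ → ℝ)
    (h : ∀ γ, c (σ * γ⁻¹) • u (σ * (σ * γ⁻¹)⁻¹) = c γ • r σ (u γ))
    (Λ : W →ₗ[ℝ] W →ₗ[ℝ] U) :
    ∑ γ, c γ • Λ (r σ (u γ) - u γ) (u (σ * γ⁻¹)) =
      - ∑ γ, c γ • Λ (u (σ * γ⁻¹)) (r σ (u γ) - u γ) := by
  have key : ∀ M : W →ₗ[ℝ] W →ₗ[ℝ] U, ∑ γ, c γ • M (u γ) (u (σ * γ⁻¹)) =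
      ∑ γ, c γ • M (u (σ * γ⁻¹)) (r σ (u γ)) := fun M => by
    refine (Fintype.sum_equiv ((Equiv.inv Γ).trans (Equiv.mulLeft σ)) _ _ fun γ => ?_).symm
    change _ = c (σ * γ⁻¹) • M (u (σ * γ⁻¹)) (u (σ * (σ * γ⁻¹)⁻¹))
    rw [← map_smul (M _) (c (σ * γ⁻¹)), h, map_smul]
  have k1 := key Λ
  have k2 := key Λ.flip
  simp only [LinearMap.flip_apply] at k2
  simp only [map_sub, LinearMap.sub_apply, smul_sub, Finset.sum_sub_distrib, ← k1, ← k2]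
  abel

variable [FiniteDimensional ℝ W]

/-- With `φ` the common four-form and `τ = σ - 1`, the left side is `J = ∑ c_γ φ(u_γ, x, y, z)
u_{σγ⁻¹}`. For `θ` with `τθτ = τ`, the form `K = ½ ∑ c_γ φ(u_γ, θu_{σγ⁻¹}, ·, ·)` works: by the
Plücker relation its coboundary is half of `∑ c_γ φ(u_γ, x, y, z) τθu_{σγ⁻¹} - ∑ c_γ φ(θu_{σγ⁻¹}, x,
y, z) τu_γ`, and the Hurwitz symmetry shows that both terms, with their signs, equal `J`. -/
theorem exists_scalar_component
    (hB : ∀ γ x y, B γ x y = (p γ x * q γ y - p γ y * q γ x) • u γ)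
    (hE : ∀ g γ x y, r g (B γ x y) = B (g * γ * g⁻¹) (r g x) (r g y))
    (hu : ∀ γ, r γ (u γ) = u γ)
    (hfix : ∀ γ z, r γ z = z → p γ z = 0 ∧ q γ z = 0)
    (hmove : ∀ γ, p γ = 0 ∨ ∃ m m' : W, ∀ z, r γ z = z + p γ z • m + q γ z • m') (σ : Γ) :
    ∃ K : W →ₗ[ℝ] W →ₗ[ℝ] ℝ, (∀ x, K x x = 0) ∧ ∀ x y z,
      ∑ γ, (B (σ * γ⁻¹) (B γ x y) z + B (σ * γ⁻¹) (B γ y z) x + B (σ * γ⁻¹) (B γ z x) y) =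
        K x y • (r σ z - z) + K y z • (r σ x - x) + K z x • (r σ y - y) := by
  simp only [cyclic_eq_vol4_smul p q u B hB fun γ => hfix γ _ (hu γ)]
  by_cases h0 : ∀ γ a x y z, vol4 (fourForms p q σ γ) a x y z = 0
  · exact ⟨0, fun x => rfl, fun x y z => by simp [h0]⟩
  push Not at h0
  obtain ⟨γ₀, a₀, x₀, y₀, z₀, hv⟩ := h0
  choose c hc using exists_vol4_fourForms_eq r p q hfix hmove hv
  set φ := fourForms p q σ γ₀ with hφ
  have hhur : ∀ γ, c (σ * γ⁻¹) • u (σ * (σ * γ⁻¹)⁻¹) = c γ • r σ (u γ) := fun γ => by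
    have h1 := vol4_hurwitz r p q u B hB hE hmove γ (σ * γ⁻¹) a₀ x₀ y₀ z₀
    have h2 : σ * γ⁻¹ * γ * (σ * γ⁻¹)⁻¹ = σ * (σ * γ⁻¹)⁻¹ := by group
    have h3 : r (σ * γ⁻¹) (u γ) = r σ (u γ) := by
      nth_rw 1 [← hu γ]
      rw [← Module.End.mul_apply, ← map_mul, inv_mul_cancel_right]
    rw [h2, h3] at h1
    change vol4 (fourForms p q σ (σ * γ⁻¹)) a₀ x₀ y₀ z₀ • _ =
      vol4 (fourForms p q σ γ) a₀ x₀ y₀ z₀ • _ at h1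
    rw [hc (σ * γ⁻¹), hc γ, mul_comm (c (σ * γ⁻¹)), mul_smul, mul_comm (c γ), mul_smul] at h1
    exact smul_right_injective W hv h1
  obtain ⟨θ, hθ⟩ := exists_comp_comp_eq (r σ - LinearMap.id)
  simp only [LinearMap.sub_apply, LinearMap.id_apply] at hθ
  have hkill : ∀ s, (∀ i, φ i s = 0) → r σ s - s = 0 := fun s hs =>
    sub_eq_zero.2 (fixed_of_fourForms_eq_zero r p q hmove hv hs)
  -- `θτs - s` is fixed by `σ`, because `τθτ = τ`, and the forms of `φ` vanish on such vectors.
  have hDθ : ∀ s x y z, vol4 φ (θ (r σ s - s)) x y z = vol4 φ s x y z := fun s x y z => by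
    have h1 : ∀ i, φ i (θ (r σ s - s) - s) = 0 := fun i => by
      refine fourForms_eq_zero_of_fixed r p q hfix hmove hv (sub_eq_zero.1 ?_) i
      have := hθ s
      rw [map_sub (r σ) (θ _) s, sub_sub_sub_comm, this, sub_self]
    have h2 : ∀ i, φ i (θ (r σ s - s)) = φ i s := fun i => by
      have := h1 i
      rwa [map_sub, sub_eq_zero] at this
    simp only [vol4_eq, h2]
  -- The Plücker combination is killed by all four forms, hence fixed by `σ`; applying `σ - 1` to it
  -- gives zero.
  have hpl : ∀ a b x y z, vol4 φ a b x y • (r σ z - z) + vol4 φ a b y z • (r σ x - x) +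
      vol4 φ a b z x • (r σ y - y) =
      vol4 φ a x y z • (r σ b - b) - vol4 φ b x y z • (r σ a - a) := fun a b x y z => by
    have h1 := hkill _ fun i => apply_plucker φ a b x y z i
    simp only [map_add, map_sub, map_smul] at h1
    rw [← sub_eq_zero, ← h1]
    module
  refine ⟨(2⁻¹ : ℝ) • ∑ γ, c γ • vol4Contract φ (u γ) (θ (u (σ * γ⁻¹))), fun x => ?_,
    fun x y z => ?_⟩
  · simp [LinearMap.sum_apply, vol4Contract_apply, vol4_self]
  set Λ : W →ₗ[ℝ] W →ₗ[ℝ] W := LinearMap.mk₂ ℝ (fun s t => vol4 φ (θ s) x y z • t)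
    (fun s s' t => by rw [map_add, vol4_add_left, add_smul])
    (fun k s t => by rw [map_smul, vol4_smul_left, mul_smul])
    (fun s t t' => smul_add _ _ _) (fun k s t => smul_comm _ _ _) with hΛ
  have hsum := sum_hurwitz r u σ c hhur Λ
  simp only [hΛ, LinearMap.mk₂_apply, hDθ] at hsum
  set J : W := ∑ γ, c γ • vol4 φ (u γ) x y z • u (σ * γ⁻¹) with hJ
  have hL : ∑ γ, vol4 (fourForms p q σ γ) (u γ) x y z • u (σ * γ⁻¹) = J :=
    Finset.sum_congr rfl fun γ _ => by rw [hc, mul_smul]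
  -- The Hurwitz symmetry exhibits `J` in the image of `τ`, on which `τθ` is the identity.
  have hτJ : r σ (θ J) - θ J = J := by
    have h1 : J = r σ (-∑ γ, c γ • vol4 φ (θ (u (σ * γ⁻¹))) x y z • u γ) -
        (-∑ γ, c γ • vol4 φ (θ (u (σ * γ⁻¹))) x y z • u γ) := by
      rw [hsum, map_neg, map_sum, sub_neg_eq_add, neg_add_eq_sub, ← Finset.sum_sub_distrib,
        ← Finset.sum_neg_distrib]
      refine Finset.sum_congr rfl fun γ _ => ?_
      rw [map_smul, map_smul]
      module
    rw [h1]
    exact hθ _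
  have hτθ : ∑ γ, c γ • vol4 φ (u γ) x y z • (r σ (θ (u (σ * γ⁻¹))) - θ (u (σ * γ⁻¹))) = J := by
    nth_rw 1 [← hτJ]
    simp only [hJ, map_sum, map_smul, smul_sub, Finset.sum_sub_distrib]
  have hR : ∀ x y z, (((2⁻¹ : ℝ) • ∑ γ, c γ • vol4Contract φ (u γ) (θ (u (σ * γ⁻¹)))) x y) •
      (r σ z - z) = (2⁻¹ : ℝ) • ∑ γ, c γ • vol4 φ (u γ) (θ (u (σ * γ⁻¹))) x y • (r σ z - z) :=
    fun x y z => by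
      simp only [LinearMap.smul_apply, LinearMap.sum_apply, vol4Contract_apply, smul_eq_mul,
        mul_smul, Finset.sum_smul]
  rw [hL, hR, hR, hR, ← smul_add, ← smul_add, ← Finset.sum_add_distrib, ← Finset.sum_add_distrib]
  simp only [← smul_add, hpl]
  simp only [smul_sub (c _), Finset.sum_sub_distrib]
  rw [hτθ, sub_eq_add_neg, ← hsum, ← two_smul ℝ J, inv_smul_smul₀ two_ne_zero]

/-- The quadratic expression of the components `x ∧ y ↦ (p ∧ q) (x, y) u` is a coboundary of an
equivariant family of alternating forms. -/
theorem exists_equivariant_scalar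
    (hB : ∀ γ x y, B γ x y = (p γ x * q γ y - p γ y * q γ x) • u γ)
    (hE : ∀ g γ x y, r g (B γ x y) = B (g * γ * g⁻¹) (r g x) (r g y))
    (hu : ∀ γ, r γ (u γ) = u γ)
    (hfix : ∀ γ z, r γ z = z → p γ z = 0 ∧ q γ z = 0)
    (hmove : ∀ γ, p γ = 0 ∨ ∃ m m' : W, ∀ z, r γ z = z + p γ z • m + q γ z • m') :
    ∃ κ : Γ → W →ₗ[ℝ] W →ₗ[ℝ] ℝ, (∀ σ x, κ σ x x = 0) ∧
      (∀ g σ x y, κ (g * σ * g⁻¹) (r g x) (r g y) = κ σ x y) ∧ ∀ σ x y z,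
      ∑ γ, (B (σ * γ⁻¹) (B γ x y) z + B (σ * γ⁻¹) (B γ y z) x + B (σ * γ⁻¹) (B γ z x) y) =
        κ σ x y • (r σ z - z) + κ σ y z • (r σ x - x) + κ σ z x • (r σ y - y) := by
  choose K hK0 hK using exists_scalar_component r p q u B hB hE hu hfix hmove
  let κ : Γ → W →ₗ[ℝ] W →ₗ[ℝ] ℝ := fun σ => (Fintype.card Γ : ℝ)⁻¹ •
    ∑ g, (K (g * σ * g⁻¹)).compl₁₂ (r g) (r g)
  have hκ : ∀ σ x y, κ σ x y =
      (Fintype.card Γ : ℝ)⁻¹ * ∑ g, K (g * σ * g⁻¹) (r g x) (r g y) := fun σ x y => by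
    simp [κ]
  refine ⟨κ, fun σ x => ?_, fun g σ x y => ?_, fun σ x y z => ?_⟩
  · simp [hκ, hK0]
  · rw [hκ, hκ]
    congr 1
    refine Fintype.sum_equiv (Equiv.mulRight g) _ _ fun k => ?_
    rw [Equiv.coe_mulRight, map_mul, Module.End.mul_apply, Module.End.mul_apply]
    congr 3
    group
  set J := ∑ γ, (B (σ * γ⁻¹) (B γ x y) z + B (σ * γ⁻¹) (B γ y z) x + B (σ * γ⁻¹) (B γ z x) y)
    with hJ
  -- The equation for `gσg⁻¹`, pulled back along `g`, is again an equation for `σ`. Averaging these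
  -- over `g` makes the solution equivariant.
  have hg : ∀ g, J = K (g * σ * g⁻¹) (r g x) (r g y) • (r σ z - z) +
      K (g * σ * g⁻¹) (r g y) (r g z) • (r σ x - x) +
      K (g * σ * g⁻¹) (r g z) (r g x) • (r σ y - y) := fun g => by
    have h1 : r g J = _ := (?_ : _ = ∑ γ, (B (g * σ * g⁻¹ * γ⁻¹) (B γ (r g x) (r g y)) (r g z) +
      B (g * σ * g⁻¹ * γ⁻¹) (B γ (r g y) (r g z)) (r g x) +
      B (g * σ * g⁻¹ * γ⁻¹) (B γ (r g z) (r g x)) (r g y))).trans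
        (hK (g * σ * g⁻¹) (r g x) (r g y) (r g z))
    · have h2 : ∀ z, r (g * σ * g⁻¹) (r g z) = r g (r σ z) := fun z => by
        rw [← Module.End.mul_apply, ← map_mul, inv_mul_cancel_right, map_mul, Module.End.mul_apply]
      simp only [h2, ← map_sub, ← map_smul, ← map_add] at h1
      have h3 := congrArg (r g⁻¹) h1
      rwa [rep_inv_apply, rep_inv_apply] at h3
    · rw [hJ, map_sum]
      refine Fintype.sum_equiv (MulAut.conj g).toEquiv _ _ fun γ => ?_
      have h2 : g * σ * g⁻¹ * (MulAut.conj g γ)⁻¹ = g * (σ * γ⁻¹) * g⁻¹ := by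
        rw [MulAut.conj_apply]; group
      change _ = B (g * σ * g⁻¹ * (MulAut.conj g γ)⁻¹) (B (MulAut.conj g γ) _ _) _ +
        B (g * σ * g⁻¹ * (MulAut.conj g γ)⁻¹) (B (MulAut.conj g γ) _ _) _ +
        B (g * σ * g⁻¹ * (MulAut.conj g γ)⁻¹) (B (MulAut.conj g γ) _ _) _
      rw [h2, MulAut.conj_apply, ← hE, ← hE, ← hE, ← hE, ← hE, ← hE, map_add, map_add]
  have hcard : (Fintype.card Γ : ℝ) ≠ 0 := Nat.cast_ne_zero.2 Fintype.card_ne_zero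
  have hsum : (Fintype.card Γ : ℝ) • J = ∑ _g : Γ, J := by
    rw [Finset.sum_const, Finset.card_univ, Nat.cast_smul_eq_nsmul]
  rw [← inv_smul_smul₀ hcard J, hsum, Finset.sum_congr rfl fun g _ => hg g]
  simp only [hκ, Finset.sum_add_distrib, ← Finset.sum_smul, smul_add, mul_smul]

end Scalar
end
end CrossedPoisson

namespace CrossedPoisson

open scoped InnerProductSpace

noncomputable section

/-! ### The bracket of `π` with one of its components -/

section LieAlgebra

variable {W : Type*} [AddCommGroup W] [Module ℝ W]

/-- The compatibility of a Lie bracket with the component of it attached to an operator whose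
image is spanned by two vectors. -/
theorem mixed_cyclic_eq_zero (π : W →ₗ[ℝ] W →ₗ[ℝ] W) (halt : ∀ x, π x x = 0)
    (hjac : ∀ x y z, π (π x y) z + π (π y z) x + π (π z x) y = 0)
    (F N : W →ₗ[ℝ] W) (hFN : ∀ x, F x + N x = x) (hN : ∀ x, N (N x) = N x)
    (hff : ∀ x y, N (π (F x) (F y)) = 0) (hfn : ∀ x y, F (π (F x) (N y)) = 0)
    (p q : Module.Dual ℝ W) (e e' : W) (hpq : ∀ x, N x = p x • e + q x • e') (x y z : W) :
    (π (F (π (N x) (N y))) z + F (π (N (π x y)) (N z))) +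
      (π (F (π (N y) (N z))) x + F (π (N (π y z)) (N x))) +
      (π (F (π (N z) (N x))) y + F (π (N (π z x)) (N y))) = 0 := by
  have hswap : ∀ x y, π y x = -π x y := fun x y => by
    have := halt (x + y)
    simp only [map_add, LinearMap.add_apply, halt, zero_add, add_zero] at this
    exact eq_neg_of_add_eq_zero_left this
  have hFF : ∀ x, F (F x) = F x := fun x => by
    have h1 : N (F x) = 0 := by
      have := congrArg N (hFN x)
      rwa [map_add, hN, add_eq_right] at this
    have := hFN (F x)
    rwa [h1, add_zero] at this
  have hnf : ∀ x y, F (π (N x) (F y)) = 0 := fun x y => by rw [hswap, map_neg, hfn, neg_zero]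
  have hNfn : ∀ x y, N (π (F x) (N y)) = π (F x) (N y) := fun x y => by
    have := hFN (π (F x) (N y))
    rwa [hfn, zero_add] at this
  have hNnf : ∀ x y, N (π (N x) (F y)) = π (N x) (F y) := fun x y => by
    have := hFN (π (N x) (F y))
    rwa [hnf, zero_add] at this
  have hFff : ∀ x y, F (π (F x) (F y)) = π (F x) (F y) := fun x y => by
    have := hFN (π (F x) (F y))
    rwa [hff, add_zero] at this
  -- The fixed part of the Jacobi identity for two normal arguments and one fixed argument.
  have hmix : ∀ x y z, π (F (π (N x) (N y))) (F z) + F (π (π (N y) (F z)) (N x)) +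
      F (π (π (F z) (N x)) (N y)) = 0 := fun x y z => by
    have h1 := congrArg F (hjac (N x) (N y) (F z))
    rw [map_zero, map_add, map_add] at h1
    have h2 : F (π (π (N x) (N y)) (F z)) = π (F (π (N x) (N y))) (F z) := by
      nth_rw 1 [← hFN (π (N x) (N y))]
      rw [map_add, LinearMap.add_apply, map_add, hnf, add_zero, hFff]
    rwa [h2] at h1
  -- With three normal arguments the expression is alternating and trilinear in the two coordinates
  -- `p, q`, hence zero.
  have hnnn : (π (F (π (N x) (N y))) (N z) + F (π (N (π (N x) (N y))) (N z))) +
      (π (F (π (N y) (N z))) (N x) + F (π (N (π (N y) (N z))) (N x))) +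
      (π (F (π (N z) (N x))) (N y) + F (π (N (π (N z) (N x))) (N y))) = 0 := by
    have h1 : ∀ x y, π (N x) (N y) = (p x * q y - p y * q x) • π e e' := fun x y => by
      simp only [hpq, map_add, map_smul, LinearMap.add_apply, LinearMap.smul_apply, halt,
        hswap e e']
      module
    have h2 : ∀ a z, π a (N z) = p z • π a e + q z • π a e' := fun a z => by
      rw [hpq, map_add, map_smul, map_smul]
    simp only [h1, map_smul, LinearMap.smul_apply, h2]
    module
  have hone : ∀ x y z, π (F (π (N x) (N y))) z + F (π (N (π x y)) (N z)) =
      π (F (π (N x) (N y))) (F z) + F (π (π (F x) (N y)) (N z)) + F (π (π (N x) (F y)) (N z)) +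
      (π (F (π (N x) (N y))) (N z) + F (π (N (π (N x) (N y))) (N z))) := fun x y z => by
    have h1 : π x y = π (F x) (F y) + π (F x) (N y) + π (N x) (F y) + π (N x) (N y) := by
      conv_lhs => rw [← hFN x, ← hFN y]
      simp only [map_add, LinearMap.add_apply]
      abel
    have h2 : N (π x y) = π (F x) (N y) + π (N x) (F y) + N (π (N x) (N y)) := by
      rw [h1, map_add, map_add, map_add, hff, hNfn, hNnf, zero_add]
    have h3 : π (F (π (N x) (N y))) z =
        π (F (π (N x) (N y))) (F z) + π (F (π (N x) (N y))) (N z) := by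
      rw [← map_add, hFN]
    rw [h2, h3]
    simp only [map_add, LinearMap.add_apply]
    abel
  rw [hone x y z, hone y z x, hone z x y]
  have m1 := hmix x y z
  have m2 := hmix y z x
  have m3 := hmix z x y
  have key := congrArg₂ (· + ·) (congrArg₂ (· + ·) (congrArg₂ (· + ·) m1 m2) m3) hnnn
  simp only [add_zero] at key
  rw [← key]
  abel

open Classical in
/-- The quadratic expression of a bracket at the identity plus a family of components. -/
theorem sum_bracket_add {Γ : Type*} [Group Γ] [Fintype Γ] (π : W →ₗ[ℝ] W →ₗ[ℝ] W)
    (B : Γ → W →ₗ[ℝ] W →ₗ[ℝ] W) (σ : Γ) (x y z : W) :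
    ∑ γ, ((if σ * γ⁻¹ = 1 then π else 0) + B (σ * γ⁻¹)) (((if γ = 1 then π else 0) + B γ) x y) z =
      (if σ = 1 then π (π x y) z else 0) + (π (B σ x y) z + B σ (π x y) z) +
        ∑ γ, B (σ * γ⁻¹) (B γ x y) z := by
  simp only [LinearMap.add_apply, map_add, Finset.sum_add_distrib]
  have h1 : ∀ C : Γ → W, ∑ γ, (if σ * γ⁻¹ = 1 then π else 0) (C γ) z = π (C σ) z := fun C => by
    rw [Finset.sum_eq_single σ]
    · rw [mul_inv_cancel, if_pos rfl]
    · intro γ _ hγ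
      rw [if_neg fun h => hγ (mul_inv_eq_one.1 h).symm]
      simp
    · simp
  have h2 : ∑ γ, B (σ * γ⁻¹) ((if γ = 1 then π else 0) x y) z = B σ (π x y) z := by
    rw [Finset.sum_eq_single 1]
    · simp
    · intro γ _ hγ
      rw [if_neg hγ]
      simp
    · simp
  rw [h1, h1, h2]
  split_ifs
  · abel
  · simp only [LinearMap.zero_apply, map_zero]
    abel

end LieAlgebra

/-! ### Fixed and normal parts of linear forms -/

section Euclidean

variable {Γ : Type*} [Group Γ]
  {V : Type*} [NormedAddCommGroup V] [InnerProductSpace ℝ V] (ρ : Representation ℝ Γ V)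

theorem mem_fixedSpace {γ : Γ} {v : V} : v ∈ fixedSpace ρ γ ↔ ρ γ v = v := by
  rw [fixedSpace, LinearMap.mem_ker, LinearMap.sub_apply, LinearMap.id_apply, sub_eq_zero]

theorem dual_apply_apply (g : Γ) (x : Module.Dual ℝ V) (v : V) :
    ρ.dual g x v = x (ρ g⁻¹ v) := rfl

theorem codim_one : codim ρ (1 : Γ) = 0 := by
  have : fixedSpace ρ (1 : Γ) = ⊤ := by
    rw [fixedSpace, map_one, Module.End.one_eq_id, sub_self, LinearMap.ker_zero]
  rw [codim, normalSpace, this, Submodule.top_orthogonal_eq_bot, finrank_bot]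

theorem ne_one_of_codim {γ : Γ} (h : codim ρ γ = 2) : γ ≠ 1 := by
  rintro rfl
  rw [codim_one] at h
  omega

theorem mem_fixedSpace_conj {g γ : Γ} {v : V} :
    v ∈ fixedSpace ρ (g * γ * g⁻¹) ↔ ρ g⁻¹ v ∈ fixedSpace ρ γ := by
  rw [mem_fixedSpace, mem_fixedSpace, map_mul, map_mul, Module.End.mul_apply, Module.End.mul_apply]
  constructor <;> intro h
  · nth_rw 2 [← h]
    rw [rep_inv_apply]
  · rw [h, rep_apply_inv]

variable [FiniteDimensional ℝ V]

theorem toFixedDual_apply (γ : Γ) (x : Module.Dual ℝ V) (v : V) :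
    toFixedDual ρ γ x v = x ((fixedSpace ρ γ).starProjection v) := rfl

theorem toNormalDual_apply (γ : Γ) (x : Module.Dual ℝ V) (v : V) :
    toNormalDual ρ γ x v = x ((normalSpace ρ γ).starProjection v) := rfl

theorem proj_apply (π : LinBivector V) (γ : Γ) (x y : Module.Dual ℝ V) :
    proj ρ π γ x y = toFixedDual ρ γ (π (toNormalDual ρ γ x) (toNormalDual ρ γ y)) := rfl

theorem toFixedDual_add_toNormalDual (γ : Γ) (x : Module.Dual ℝ V) :
    toFixedDual ρ γ x + toNormalDual ρ γ x = x := by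
  ext v
  rw [LinearMap.add_apply, toFixedDual_apply, toNormalDual_apply, ← map_add, normalSpace,
    Submodule.starProjection_add_starProjection_orthogonal]

theorem toNormalDual_toNormalDual (γ : Γ) (x : Module.Dual ℝ V) :
    toNormalDual ρ γ (toNormalDual ρ γ x) = toNormalDual ρ γ x := by
  ext v
  rw [toNormalDual_apply, toNormalDual_apply, toNormalDual_apply,
    Submodule.starProjection_eq_self_iff.2 (Submodule.starProjection_apply_mem _ _)]

theorem codim_conj (g γ : Γ) : codim ρ (g * γ * g⁻¹) = codim ρ γ := by
  have hle : ∀ g γ, Module.finrank ℝ (fixedSpace ρ (g * γ * g⁻¹)) ≤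
      Module.finrank ℝ (fixedSpace ρ γ) := fun g γ => by
    refine le_trans (Submodule.finrank_mono ?_) (Submodule.finrank_map_le (ρ g) (fixedSpace ρ γ))
    exact fun v hv => ⟨ρ g⁻¹ v, (mem_fixedSpace_conj ρ).1 hv, rep_apply_inv ρ g v⟩
  have h1 := hle g γ
  have h2 := hle g⁻¹ (g * γ * g⁻¹)
  have h3 : g⁻¹ * (g * γ * g⁻¹) * g⁻¹⁻¹ = γ := by group
  rw [h3] at h2
  have h4 := (fixedSpace ρ γ).finrank_add_finrank_orthogonal
  have h5 := (fixedSpace ρ (g * γ * g⁻¹)).finrank_add_finrank_orthogonal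
  rw [codim, codim, normalSpace, normalSpace]
  omega

/-- The coordinates of the normal part of a linear form, for an element of codimension two. -/
theorem exists_toNormalDual_eq {γ : Γ} (h : codim ρ γ = 2) :
    ∃ (p q : Module.Dual ℝ (Module.Dual ℝ V)) (e e' : Module.Dual ℝ V),
      (∀ x, toNormalDual ρ γ x = p x • e + q x • e') ∧
      ∀ x, toNormalDual ρ γ x = 0 → p x = 0 ∧ q x = 0 := by
  let b := Module.finBasisOfFinrankEq ℝ (normalSpace ρ γ) h
  let P : V →ₗ[ℝ] normalSpace ρ γ := (normalSpace ρ γ).orthogonalProjectionOnto.toLinearMap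
  have hb : ∀ i x, toNormalDual ρ γ x (b i) = x (b i) := fun i x => by
    rw [toNormalDual_apply, Submodule.starProjection_eq_self_iff.2 (b i).2]
  refine ⟨Module.Dual.eval ℝ V (b 0), Module.Dual.eval ℝ V (b 1), b.coord 0 ∘ₗ P, b.coord 1 ∘ₗ P,
    fun x => ?_, fun x hx => ⟨?_, ?_⟩⟩
  · ext v
    have h1 : (normalSpace ρ γ).starProjection v = ((P v : normalSpace ρ γ) : V) := rfl
    have h2 := congrArg (fun w : normalSpace ρ γ => x w) (b.sum_repr (P v))
    rw [Fin.sum_univ_two] at h2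
    rw [toNormalDual_apply, h1, ← h2]
    simp [mul_comm]
  · rw [Module.Dual.eval_apply, ← hb, hx, LinearMap.zero_apply]
  · rw [Module.Dual.eval_apply, ← hb, hx, LinearMap.zero_apply]

theorem starProjection_fixedSpace_conj
    (hmetric : ∀ (g : Γ) (v w : V), inner ℝ (ρ g v) (ρ g w) = inner ℝ v w)
    (g γ : Γ) (v : V) :
    (fixedSpace ρ (g * γ * g⁻¹)).starProjection v =
      ρ g ((fixedSpace ρ γ).starProjection (ρ g⁻¹ v)) := by
  refine Submodule.eq_starProjection_of_mem_of_inner_eq_zero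
    (K := fixedSpace ρ (g * γ * g⁻¹)) ?_ fun w hw => ?_
  · rw [mem_fixedSpace_conj, rep_inv_apply]
    exact Submodule.starProjection_apply_mem _ _
  · rw [← hmetric g⁻¹, map_sub, rep_inv_apply]
    exact Submodule.starProjection_inner_eq_zero _ _ ((mem_fixedSpace_conj ρ).1 hw)

theorem dual_toFixedDual
    (hmetric : ∀ (g : Γ) (v w : V), inner ℝ (ρ g v) (ρ g w) = inner ℝ v w)
    (g γ : Γ) (x : Module.Dual ℝ V) :
    ρ.dual g (toFixedDual ρ γ x) = toFixedDual ρ (g * γ * g⁻¹) (ρ.dual g x) := by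
  ext v
  rw [dual_apply_apply, toFixedDual_apply, toFixedDual_apply, dual_apply_apply,
    starProjection_fixedSpace_conj ρ hmetric, rep_inv_apply]

theorem dual_toNormalDual
    (hmetric : ∀ (g : Γ) (v w : V), inner ℝ (ρ g v) (ρ g w) = inner ℝ v w)
    (g γ : Γ) (x : Module.Dual ℝ V) :
    ρ.dual g (toNormalDual ρ γ x) = toNormalDual ρ (g * γ * g⁻¹) (ρ.dual g x) := by
  have h1 := congrArg (ρ.dual g) (toFixedDual_add_toNormalDual ρ γ x)
  rw [map_add, dual_toFixedDual ρ hmetric] at h1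
  have h2 := toFixedDual_add_toNormalDual ρ (g * γ * g⁻¹) (ρ.dual g x)
  exact add_left_cancel (h1.trans h2.symm)

theorem dual_toFixedDual_self
    (hmetric : ∀ (g : Γ) (v w : V), inner ℝ (ρ g v) (ρ g w) = inner ℝ v w)
    (γ : Γ) (x : Module.Dual ℝ V) :
    ρ.dual γ (toFixedDual ρ γ x) = toFixedDual ρ γ x := by
  ext v
  have h1 := starProjection_fixedSpace_conj ρ hmetric γ⁻¹ γ (ρ γ⁻¹ v)
  have h2 : γ⁻¹ * γ * γ⁻¹⁻¹ = γ := by group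
  have h3 := (mem_fixedSpace ρ).1 ((fixedSpace ρ γ).starProjection_apply_mem v)
  rw [h2, inv_inv, rep_apply_inv, ← h3, rep_inv_apply] at h1
  rw [dual_apply_apply, toFixedDual_apply, toFixedDual_apply, h1]

/-- An invariant form is the inner product with an invariant vector, which is orthogonal to the
normal space. -/
theorem toNormalDual_eq_zero_of_fixed
    (hmetric : ∀ (g : Γ) (v w : V), inner ℝ (ρ g v) (ρ g w) = inner ℝ v w)
    {γ : Γ} {x : Module.Dual ℝ V} (hx : ρ.dual γ x = x) :
    toNormalDual ρ γ x = 0 := by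
  obtain ⟨w, hw⟩ : ∃ w, ∀ v, x v = inner ℝ w v :=
    ⟨(InnerProductSpace.toDual ℝ V).symm (LinearMap.toContinuousLinearMap x), fun v => by simp⟩
  have hfix : ρ γ w = w := ext_inner_right ℝ fun v => by
    rw [← hmetric γ⁻¹, rep_inv_apply, ← hw, ← hw, ← dual_apply_apply, hx]
  ext v
  rw [toNormalDual_apply, hw]
  exact Submodule.inner_right_of_mem_orthogonal ((mem_fixedSpace ρ).2 hfix)
    (Submodule.starProjection_apply_mem _ _)

/-- By biduality `x ↦ f x v` is evaluation at a vector `w`; invariance makes `w` fixed by `γ`, so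
its normal projection is zero. -/
theorem apply_toNormalDual_eq_zero {γ : Γ} (f : Module.Dual ℝ V →ₗ[ℝ] Module.Dual ℝ V)
    (hf : ∀ x, f (ρ.dual γ x) = f x) (x : Module.Dual ℝ V) : f (toNormalDual ρ γ x) = 0 := by
  ext v
  obtain ⟨w, hw⟩ : ∃ w, ∀ x, f x v = x w := by
    obtain ⟨w, hw⟩ := (Module.evalEquiv ℝ V).surjective (Module.Dual.eval ℝ V v ∘ₗ f)
    exact ⟨w, fun x => (LinearMap.congr_fun hw x).symm⟩
  have hfix : ρ γ⁻¹ w = w := by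
    rw [← sub_eq_zero, ← Module.forall_dual_apply_eq_zero_iff ℝ]
    intro x
    rw [map_sub, ← dual_apply_apply, ← hw, ← hw, hf, sub_self]
  have hmem : w ∈ fixedSpace ρ γ := by
    rw [mem_fixedSpace]
    nth_rw 1 [← hfix]
    rw [rep_apply_inv]
  rw [hw, toNormalDual_apply, (Submodule.starProjection_apply_eq_zero_iff _).2, map_zero,
    LinearMap.zero_apply]
  rw [normalSpace, Submodule.orthogonal_orthogonal]
  exact hmem

end Euclidean
end
end CrossedPoisson

namespace CrossedPoisson

open scoped InnerProductSpace

noncomputable section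

/-! ### The twisted structure and its identities -/

section Euclidean

variable {Γ : Type*} [Group Γ]
  {V : Type*} [NormedAddCommGroup V] [InnerProductSpace ℝ V] [FiniteDimensional ℝ V]
  (ρ : Representation ℝ Γ V)

theorem toNormalDual_bracket_toFixedDual
    (hmetric : ∀ (g : Γ) (v w : V), inner ℝ (ρ g v) (ρ g w) = inner ℝ v w)
    (π : LinBivector V) (hinv : IsInvariant ρ π) (γ : Γ) (x y : Module.Dual ℝ V) :
    toNormalDual ρ γ (π (toFixedDual ρ γ x) (toFixedDual ρ γ y)) = 0 := by
  refine toNormalDual_eq_zero_of_fixed ρ hmetric ?_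
  rw [← hinv, dual_toFixedDual_self ρ hmetric, dual_toFixedDual_self ρ hmetric]

theorem toFixedDual_dual
    (hmetric : ∀ (g : Γ) (v w : V), inner ℝ (ρ g v) (ρ g w) = inner ℝ v w)
    (γ : Γ) (x : Module.Dual ℝ V) : toFixedDual ρ γ (ρ.dual γ x) = toFixedDual ρ γ x := by
  have h := dual_toFixedDual ρ hmetric γ γ x
  rwa [mul_inv_cancel_right, dual_toFixedDual_self ρ hmetric, eq_comm] at h

/-- For a fixed first argument, the fixed part of the bracket is a `γ`-invariant function of the
second argument, and so kills normal forms. -/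
theorem toFixedDual_bracket
    (hmetric : ∀ (g : Γ) (v w : V), inner ℝ (ρ g v) (ρ g w) = inner ℝ v w)
    (π : LinBivector V) (hinv : IsInvariant ρ π) (γ : Γ) (x y : Module.Dual ℝ V) :
    toFixedDual ρ γ (π (toFixedDual ρ γ x) (toNormalDual ρ γ y)) = 0 := by
  refine apply_toNormalDual_eq_zero ρ (toFixedDual ρ γ ∘ₗ π (toFixedDual ρ γ x)) (fun y => ?_) y
  rw [LinearMap.comp_apply, LinearMap.comp_apply]
  nth_rw 1 [← dual_toFixedDual_self ρ hmetric γ x]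
  rw [hinv, toFixedDual_dual ρ hmetric]

open Classical in
/-- The components of `twisted` at the elements of codimension two. -/
def twistedNormal (π : LinBivector V) (c : Γ → ℝ) (γ : Γ) : LinBivector V :=
  if codim ρ γ = 2 then c γ • proj ρ π γ else 0

theorem twistedNormal_of_codim (π : LinBivector V) (c : Γ → ℝ) {γ : Γ} (h : codim ρ γ = 2)
    (x y : Module.Dual ℝ V) : twistedNormal ρ π c γ x y = c γ • proj ρ π γ x y := by
  rw [twistedNormal, if_pos h]; rfl

theorem twistedNormal_of_codim_ne (π : LinBivector V) (c : Γ → ℝ) {γ : Γ} (h : codim ρ γ ≠ 2) :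
    twistedNormal ρ π c γ = 0 := if_neg h

open Classical in
theorem twisted_eq (π : LinBivector V) (c : Γ → ℝ) (γ : Γ) :
    twisted ρ π c γ = (if γ = 1 then π else 0) + twistedNormal ρ π c γ := rfl

theorem twisted_of_ne_one (π : LinBivector V) (c : Γ → ℝ) {γ : Γ} (h : γ ≠ 1) :
    twisted ρ π c γ = twistedNormal ρ π c γ := by
  rw [twisted_eq, if_neg h, zero_add]

theorem twistedNormal_self (π : LinBivector V) (halt : ∀ x, π x x = 0) (c : Γ → ℝ) (γ : Γ)
    (x : Module.Dual ℝ V) : twistedNormal ρ π c γ x x = 0 := by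
  by_cases h : codim ρ γ = 2
  · rw [twistedNormal_of_codim ρ π c h, proj_apply, halt, map_zero, smul_zero]
  · rw [twistedNormal_of_codim_ne ρ π c h]; rfl

theorem twisted_self (π : LinBivector V) (halt : ∀ x, π x x = 0) (c : Γ → ℝ) (γ : Γ)
    (x : Module.Dual ℝ V) : twisted ρ π c γ x x = 0 := by
  rw [twisted_eq, LinearMap.add_apply, LinearMap.add_apply, twistedNormal_self ρ π halt, add_zero]
  split_ifs
  · exact halt x
  · rfl

theorem dual_twistedNormal
    (hmetric : ∀ (g : Γ) (v w : V), inner ℝ (ρ g v) (ρ g w) = inner ℝ v w)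
    (π : LinBivector V) (hinv : IsInvariant ρ π) (c : Γ → ℝ)
    (hc : ∀ α γ : Γ, c (α * γ * α⁻¹) = c γ) (g γ : Γ) (x y : Module.Dual ℝ V) :
    ρ.dual g (twistedNormal ρ π c γ x y) =
      twistedNormal ρ π c (g * γ * g⁻¹) (ρ.dual g x) (ρ.dual g y) := by
  by_cases h : codim ρ γ = 2
  · rw [twistedNormal_of_codim ρ π c h, twistedNormal_of_codim ρ π c ((codim_conj ρ g γ).trans h),
      hc, map_smul, proj_apply, proj_apply, dual_toFixedDual ρ hmetric, ← hinv,
      dual_toNormalDual ρ hmetric, dual_toNormalDual ρ hmetric]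
  · rw [twistedNormal_of_codim_ne ρ π c h,
      twistedNormal_of_codim_ne ρ π c fun h' => h ((codim_conj ρ g γ).symm.trans h')]
    exact map_zero _

theorem dual_twisted
    (hmetric : ∀ (g : Γ) (v w : V), inner ℝ (ρ g v) (ρ g w) = inner ℝ v w)
    (π : LinBivector V) (hinv : IsInvariant ρ π) (c : Γ → ℝ)
    (hc : ∀ α γ : Γ, c (α * γ * α⁻¹) = c γ) (g γ : Γ) (x y : Module.Dual ℝ V) :
    ρ.dual g (twisted ρ π c γ x y) =
      twisted ρ π c (g * γ * g⁻¹) (ρ.dual g x) (ρ.dual g y) := by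
  rw [twisted_eq, twisted_eq, LinearMap.add_apply, LinearMap.add_apply, map_add,
    dual_twistedNormal ρ hmetric π hinv c hc, LinearMap.add_apply, LinearMap.add_apply]
  congr 1
  by_cases h : γ = 1
  · subst h
    rw [if_pos rfl, if_pos (by group), hinv]
  · rw [if_neg h, if_neg (by rwa [conj_eq_one_iff])]
    exact map_zero _

/-- A component of codimension two is the product of an area form, depending only on the normal
parts of its arguments, with a fixed form. -/
theorem exists_twistedNormal_eq
    (hmetric : ∀ (g : Γ) (v w : V), inner ℝ (ρ g v) (ρ g w) = inner ℝ v w)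
    (π : LinBivector V) (halt : ∀ x, π x x = 0) (c : Γ → ℝ) (γ : Γ) :
    ∃ (p q : Module.Dual ℝ (Module.Dual ℝ V)) (u : Module.Dual ℝ V),
      (∀ x y, twistedNormal ρ π c γ x y = (p x * q y - p y * q x) • u) ∧ ρ.dual γ u = u ∧
      (∀ z, ρ.dual γ z = z → p z = 0 ∧ q z = 0) ∧
      (p = 0 ∨ ∃ m m', ∀ z, ρ.dual γ z = z + p z • m + q z • m') := by
  by_cases h : codim ρ γ = 2
  · obtain ⟨p, q, e, e', hN, h0⟩ := exists_toNormalDual_eq ρ h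
    -- The scalar `c γ` goes into `u`, so that `p` and `q` depend on `γ` alone. Only the normal part
    -- of `z` is moved by `γ`, which gives `m` and `m'`.
    refine ⟨p, q, c γ • toFixedDual ρ γ (π e e'), fun x y => ?_, ?_, fun z hz =>
      h0 z (toNormalDual_eq_zero_of_fixed ρ hmetric hz),
      Or.inr ⟨ρ.dual γ e - e, ρ.dual γ e' - e', fun z => ?_⟩⟩
    · have hswap : π e' e = -π e e' := by
        have := halt (e + e')
        simp only [map_add, LinearMap.add_apply, halt, zero_add, add_zero] at this
        exact eq_neg_of_add_eq_zero_left this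
      rw [twistedNormal_of_codim ρ π c h, proj_apply, hN, hN]
      simp only [map_add, map_smul, LinearMap.add_apply, LinearMap.smul_apply, halt, hswap,
        map_neg, map_zero]
      module
    · rw [map_smul, dual_toFixedDual_self ρ hmetric]
    · have hz := toFixedDual_add_toNormalDual ρ γ z
      have h1 : ρ.dual γ (toNormalDual ρ γ z) - toNormalDual ρ γ z =
          p z • (ρ.dual γ e - e) + q z • (ρ.dual γ e' - e') := by
        rw [hN, map_add, map_smul, map_smul]; module
      rw [add_assoc, ← h1]
      nth_rw 1 2 [← hz]
      rw [map_add, dual_toFixedDual_self ρ hmetric]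
      abel
  · exact ⟨0, 0, 0, fun x y => by rw [twistedNormal_of_codim_ne ρ π c h]; simp, map_zero _,
      fun _ _ => ⟨rfl, rfl⟩, Or.inl rfl⟩

/-- For `γ = 1` the differences vanish. Otherwise the coefficients are `p ∧ q ∧ p` and `p ∧ q ∧ q`.
-/
theorem twisted_tensor_cyclic
    (hmetric : ∀ (g : Γ) (v w : V), inner ℝ (ρ g v) (ρ g w) = inner ℝ v w)
    (π : LinBivector V) (halt : ∀ x, π x x = 0) (c : Γ → ℝ) (γ : Γ) (x y z : Module.Dual ℝ V) :
    twisted ρ π c γ x y ⊗ₜ[ℝ] (ρ.dual γ z - z) + twisted ρ π c γ y z ⊗ₜ[ℝ] (ρ.dual γ x - x) +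
      twisted ρ π c γ z x ⊗ₜ[ℝ] (ρ.dual γ y - y) = 0 := by
  by_cases h : γ = 1
  · subst h
    simp only [map_one, Module.End.one_apply, sub_self, TensorProduct.tmul_zero, add_zero]
  obtain ⟨p, q, u, hB, -, -, h0 | ⟨m, m', hm⟩⟩ := exists_twistedNormal_eq ρ hmetric π halt c γ
  · simp [twisted_of_ne_one ρ π c h, hB, h0]
  · have hsub : ∀ z, ρ.dual γ z - z = p z • m + q z • m' := fun z => by rw [hm]; abel
    simp only [twisted_of_ne_one ρ π c h, hB, hsub, TensorProduct.tmul_add,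
      TensorProduct.tmul_smul, ← TensorProduct.smul_tmul']
    module

theorem twistedNormal_mixed
    (hmetric : ∀ (g : Γ) (v w : V), inner ℝ (ρ g v) (ρ g w) = inner ℝ v w)
    (π : LinBivector V) (hπ : IsLiePoisson π) (hinv : IsInvariant ρ π) (c : Γ → ℝ) (σ : Γ)
    (x y z : Module.Dual ℝ V) :
    (π (twistedNormal ρ π c σ x y) z + twistedNormal ρ π c σ (π x y) z) +
      (π (twistedNormal ρ π c σ y z) x + twistedNormal ρ π c σ (π y z) x) +
      (π (twistedNormal ρ π c σ z x) y + twistedNormal ρ π c σ (π z x) y) = 0 := by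
  by_cases h : codim ρ σ = 2
  · obtain ⟨p, q, e, e', hN, -⟩ := exists_toNormalDual_eq ρ h
    have key := mixed_cyclic_eq_zero π hπ.alt hπ.jacobi (toFixedDual ρ σ) (toNormalDual ρ σ)
      (toFixedDual_add_toNormalDual ρ σ) (toNormalDual_toNormalDual ρ σ)
      (toNormalDual_bracket_toFixedDual ρ hmetric π hinv σ)
      (toFixedDual_bracket ρ hmetric π hinv σ) p q e e' hN x y z
    simp only [twistedNormal_of_codim ρ π c h, proj_apply, map_smul, LinearMap.smul_apply,
      ← smul_add]
    rw [key, smul_zero]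
  · rw [twistedNormal_of_codim_ne ρ π c h]
    simp

theorem isLinearCocycle_twisted
    (hmetric : ∀ (g : Γ) (v w : V), inner ℝ (ρ g v) (ρ g w) = inner ℝ v w)
    (π : LinBivector V) (hπ : IsLiePoisson π) (hinv : IsInvariant ρ π)
    (c : Γ → ℝ) (hc : ∀ α γ : Γ, c (α * γ * α⁻¹) = c γ) :
    IsLinearCocycle ρ (twisted ρ π c) where
  alt := twisted_self ρ π hπ.alt c
  equivariant g γ x y := by
    rw [dual_twisted ρ hmetric π hinv c hc, dual_dual_inv, dual_dual_inv]
  support γ h1 h2 := by rw [twisted_of_ne_one ρ π c h1, twistedNormal_of_codim_ne ρ π c h2]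
  value γ h x y v hv := by
    rw [twisted_of_ne_one ρ π c (ne_one_of_codim ρ h), twistedNormal_of_codim ρ π c h, proj_apply,
      LinearMap.smul_apply, toFixedDual_apply,
      (Submodule.starProjection_apply_eq_zero_iff _).2 hv, map_zero, smul_zero]
  normal γ h x y hx := by
    have h0 : toNormalDual ρ γ x = 0 := by
      ext v
      exact hx _ (Submodule.starProjection_apply_mem _ _)
    rw [twisted_of_ne_one ρ π c (ne_one_of_codim ρ h), twistedNormal_of_codim ρ π c h, proj_apply,
      h0, map_zero, LinearMap.zero_apply, map_zero, smul_zero]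

-- The Jacobi expression of `π` and the mixed terms vanish, so the scalar correction of the
-- components of codimension two serves for the whole family.
open Classical in
theorem exists_twisted_scalar [Fintype Γ]
    (hmetric : ∀ (g : Γ) (v w : V), inner ℝ (ρ g v) (ρ g w) = inner ℝ v w)
    (π : LinBivector V) (hπ : IsLiePoisson π) (hinv : IsInvariant ρ π)
    (c : Γ → ℝ) (hc : ∀ α γ : Γ, c (α * γ * α⁻¹) = c γ) :
    ∃ κ : Γ → Module.Dual ℝ V →ₗ[ℝ] Module.Dual ℝ V →ₗ[ℝ] ℝ, (∀ σ x, κ σ x x = 0) ∧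
      (∀ g σ x y, κ (g * σ * g⁻¹) (ρ.dual g x) (ρ.dual g y) = κ σ x y) ∧ ∀ σ x y z,
      ∑ γ, (twisted ρ π c (σ * γ⁻¹) (twisted ρ π c γ x y) z +
          twisted ρ π c (σ * γ⁻¹) (twisted ρ π c γ y z) x +
          twisted ρ π c (σ * γ⁻¹) (twisted ρ π c γ z x) y) =
        κ σ x y • (ρ.dual σ z - z) + κ σ y z • (ρ.dual σ x - x) + κ σ z x • (ρ.dual σ y - y) := by
  choose p q u hB hu hfix hmove using exists_twistedNormal_eq ρ hmetric π hπ.alt c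
  obtain ⟨κ, h1, h2, h3⟩ := exists_equivariant_scalar ρ.dual p q u (twistedNormal ρ π c) hB
    (dual_twistedNormal ρ hmetric π hinv c hc) hu hfix hmove
  refine ⟨κ, h1, h2, fun σ x y z => ?_⟩
  rw [← h3]
  simp only [twisted_eq, Finset.sum_add_distrib, sum_bracket_add]
  have hmix := twistedNormal_mixed ρ hmetric π hπ hinv c σ x y z
  have hjac : (if σ = 1 then π (π x y) z else 0) + (if σ = 1 then π (π y z) x else 0) +
      (if σ = 1 then π (π z x) y else 0) = 0 := by
    split_ifs
    · exact hπ.jacobi x y z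
    · simp
  refine sub_eq_zero.1 (Eq.trans ?_ ((congrArg₂ (· + ·) hjac hmix).trans (add_zero 0)))
  abel

end Euclidean
end
end CrossedPoisson

theorem mainTheorem9 {Γ : Type*} [Group Γ] [Fintype Γ]
    {V : Type*} [NormedAddCommGroup V] [InnerProductSpace ℝ V] [FiniteDimensional ℝ V]
    (ρ : Representation ℝ Γ V)
    (hfaithful : Function.Injective ρ)
    (hmetric : ∀ (g : Γ) (v w : V), inner ℝ (ρ g v) (ρ g w) = inner ℝ v w)
    (π : LinBivector V) (hπ : IsLiePoisson π) (hinv : IsInvariant ρ π)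
    (c : Γ → ℝ) (hc : ∀ α γ : Γ, c (α * γ * α⁻¹) = c γ) :
    IsLinearPoisson ρ (twisted ρ π c) := by
  obtain ⟨κ, hκ, hκE, hP2⟩ := exists_twisted_scalar ρ hmetric π hπ hinv c hc
  obtain ⟨f, h, hf, hleft, hmiddle, hright, hkoszul, hcirc⟩ := exists_twoCochains ρ
    (twisted ρ π c) (twisted_self ρ π hπ.alt c) (dual_twisted ρ hmetric π hinv c hc) κ hκ hκE
    (twisted_tensor_cyclic ρ hmetric π hπ.alt c) hP2
  refine ⟨isLinearCocycle_twisted ρ hmetric π hπ hinv c hc, f,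
    -- The Gerstenhaber bracket of `f` with itself is twice `f ∘ f`, hence the doubled primitive.
    ⟨hf, hleft, hmiddle, hright, hkoszul⟩, h + h, fun a b d => ?_⟩
  rw [gerstenhaberBracket, hcirc]
  simp only [hochschildD, LinearMap.add_apply, mul_add, add_mul]
  abel
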